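/- **Discrete-time Pontryagin maximum principle on matrix Lie groups.** Let $G$ be a matrix Lie group (a closed subgroup of $GL(n,\mathbb R)$ or $GL(n,\mathbb C)$, regarded as a real Lie group) with identity $e$ and Lie algebra $\mathfrak g=T_eG$, and let $N\ge 1$, $n_x,n_u\ge 0$ be integers. Let $s_t:G\times\mathbb R^{n_x}\to G$, $f_t:G\times\mathbb R^{n_x}\times\mathbb R^{n_u}\to\mathbb R^{n_x}$, $c_t:G\times\mathbb R^{n_x}\times\mathbb R^{n_u}\to\mathbb R$ ($0\le t\le N-1$), $c_N:G\times\mathbb R^{n_x}\to\mathbb R$ and $g_t:G\times\mathbb R^{n_x}\to\mathbb R^{n_{g_t}}$ ($1\le t\le N$) be smooth, and let $\mathbb U_t\subset\mathbb R^{n_u}$ ($0\le t\le N-1$) be convex. Assume that there is an open set $\mathcal O\subset\mathfrak g$ such that $\exp$ maps $\mathcal O$ diffeomorphically onto an open subset $\exp(\mathcal O)$ of $G$ and $s_t(q,x)\in\exp(\mathcal O)$ for all $t,q,x$; below, $\exp^{-1}$ denotes the inverse of $\exp:\mathcal O\to\exp(\mathcal O)$. Fix $(\bar q_0,\bar x_0)\in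 G\times\mathbb R^{n_x}$ and consider the problem $$\text{minimize}\quad \sum_{t=0}^{N-1}c_t(q_t,x_t,u_t)+c_N(q_N,x_N)$$ subject to $q_{t+1}=q_t\,s_t(q_t,x_t)$, $x_{t+1}=f_t(q_t,x_t,u_t)$, $u_t\in\mathbb U_t$ for $t=0,\dots,N-1$, $g_t(q_t,x_t)\le 0$ (componentwise) for $t=1,\dots,N$, and $(q_0,x_0)=(\bar q_0,\bar x_0)$. For $q\in G$ let $\Phi_q:G\to G$, $\Phi_q(p)=qp$, let $T_e\Phi_q:\mathfrak g\to T_qG$ be its tangent map at $e$ and $T_e^*\Phi_q:T_q^*G\to\mathfrak g^*$ the dual map. Let $\mathrm{Ad}_q:\mathfrak g\to\mathfrak g$, $\mathrm{Ad}_q\beta=q\beta q^{-1}$, with dual map $\mathrm{Ad}_q^*:\mathfrak g^*\to\mathfrak g^*$, $\langle \mathrm{Ad}_q^*a,\beta\rangle=\langle a,\mathrm{Ad}_q\beta\rangle$. For $\nu\in\mathbb R$ define the Hamiltonian $$H^\nu(\tau,\zeta,\xi,q,x,u)=\nu c_\tau(q,x,u)+\langle\zeta,\exp^{-1}(s_\tau(q,x))\rangle+\langle\xi,f_\tau(q,x,u)\rangle$$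 for $\tau\in\{0,\dots,N-1\}$, $\zeta\in\mathfrak g^*$, $\xi\in(\mathbb R^{n_x})^*$, $q\in G$, $x\in\mathbb R^{n_x}$, $u\in\mathbb R^{n_u}$. Regard $\mathcal D_\zeta H^\nu$ as an element of $\mathfrak g^{**}=\mathfrak g$ and $\mathcal D_\xi H^\nu$ as an element of $(\mathbb R^{n_x})^{**}=\mathbb R^{n_x}$. Let $\big((q_t,x_t)_{t=0}^N,(u_t)_{t=0}^{N-1}\big)$ be an optimal (globally minimizing) state-action trajectory of this problem. Then there exist covectors $(\zeta^t,\xi^t)\in\mathfrak g^*\times(\mathbb R^{n_x})^*$ for $t=0,\dots,N-1$, covectors $\mu^t\in(\mathbb R^{n_{g_t}})^*$ for $t=1,\dots,N$, and a scalar $\nu\in\{-1,0\}$ such that, with $\gamma_t=(t,\zeta^t,\xi^t,q_t,x_t,u_t)$, $r_t=\exp(\mathcal D_\zeta H^\nu(\gamma_t))$ and $$\rho^t=\big(\mathcal D\exp^{-1}(r_t)\circ T_e\Phi_{r_t}\big)^*\zeta^t\in\mathfrak g^*,$$ the following hold. 1. State dynamics, for $t=0,\dots,N-1$: $q_{t+1}=q_t\exp(\mathcal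 D_\zeta H^\nu(\gamma_t))$ and $x_{t+1}=\mathcal D_\xi H^\nu(\gamma_t)$. Adjoint dynamics, for $t=1,\dots,N-1$: $$\rho^{t-1}=\mathrm{Ad}^*_{\exp(-\mathcal D_\zeta H^\nu(\gamma_t))}\rho^t+T_e^*\Phi_{q_t}\big(\mathcal D_qH^\nu(\gamma_t)+\mu^t\mathcal D_qg_t(q_t,x_t)\big),\qquad \xi^{t-1}=\mathcal D_xH^\nu(\gamma_t)+\mu^t\mathcal D_xg_t(q_t,x_t).$$ 2. Transversality: $\rho^{N-1}=T_e^*\Phi_{q_N}\big(\nu\mathcal D_qc_N(q_N,x_N)+\mu^N\mathcal D_qg_N(q_N,x_N)\big)$ and $\xi^{N-1}=\nu\mathcal D_xc_N(q_N,x_N)+\mu^N\mathcal D_xg_N(q_N,x_N)$. 3. Non-positive gradient: $\langle\mathcal D_uH^\nu(\gamma_t),w-u_t\rangle\le 0$ for all $w\in\mathbb U_t$ and $t=0,\dots,N-1$. 4. Complementary slackness: $\mu^t_j\,g_t^j(q_t,x_t)=0$ for all $j=1,\dots,n_{g_t}$ and $t=1,\dots,N$. 5. Non-positivity: $\mu^t\le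 0$ (componentwise) for $t=1,\dots,N$. 6. Non-triviality: the covectors $(\zeta^t,\xi^t)_{t=0}^{N-1}$, $(\mu^t)_{t=1}^N$ and the scalar $\nu$ are not all zero. -/

import Mathlib

open Set Filter Topology
open scoped ContDiff Matrix Matrix.Norms.Operator

noncomputable section

namespace DiscretePMP

/-- The Euclidean space `ℝᵈ`. -/
abbrev Eucl (d : ℕ) : Type := EuclideanSpace ℝ (Fin d)

/-- A matrix Lie group: a closed subgroup of the group of invertible `n × n` matrices over
`𝕜 = ℝ` or `𝕜 = ℂ`, regarded as a real Lie group. -/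
abbrev MatrixLieGroup (n : ℕ) (𝕜 : Type*) [RCLike 𝕜] : Type _ :=
  ClosedSubgroup (Matrix.GeneralLinearGroup (Fin n) 𝕜)

/-- `F : S → V` is smooth, where the set `S` is regarded as a subset of the normed space `A`
through `ι`: near each of its points `F` is the restriction of a smooth map defined on an open
subset of `A`. For embedded submanifolds this is the usual smoothness of maps of manifolds. -/
def SmoothVia {S A V : Type*} [NormedAddCommGroup A] [NormedSpace ℝ A]
    [NormedAddCommGroup V] [NormedSpace ℝ V] (ι : S → A) (F : S → V) : Prop :=
  ∀ p : S, ∃ W : Set A, IsOpen W ∧ ι p ∈ W ∧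
    ∃ F' : A → V, ContDiffOn ℝ ∞ F' W ∧ ∀ p' : S, ι p' ∈ W → F p' = F' (ι p')

/-- The canonical identification of the bidual of a finite-dimensional space with the space. -/
def fromBidual {E : Type*} [NormedAddCommGroup E] [NormedSpace ℝ E] [FiniteDimensional ℝ E]
    (Φ : StrongDual ℝ (StrongDual ℝ E)) : E :=
  (Module.evalEquiv ℝ E).symm
    (Φ.toLinearMap ∘ₗ (LinearMap.toContinuousLinearMap : (E →ₗ[ℝ] ℝ) ≃ₗ[ℝ] (E →L[ℝ] ℝ)))

section Group

variable {n : ℕ} {𝕜 : Type*} [RCLike 𝕜]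

/-- The matrix underlying an element of a matrix Lie group. -/
def toMat {G : MatrixLieGroup n 𝕜} (q : G) : Matrix (Fin n) (Fin n) 𝕜 :=
  ((q : Matrix.GeneralLinearGroup (Fin n) 𝕜) : Matrix (Fin n) (Fin n) 𝕜)

theorem toMat_mul {G : MatrixLieGroup n 𝕜} (p q : G) : toMat (p * q) = toMat p * toMat q := rfl

theorem toMat_one {G : MatrixLieGroup n 𝕜} : toMat (1 : G) = 1 := rfl

theorem toMat_inv_mul {G : MatrixLieGroup n 𝕜} (q : G) : toMat q⁻¹ * toMat q = 1 := by
  rw [← toMat_mul, inv_mul_cancel, toMat_one]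

/-- The tangent space `T_q G`: the velocities at time `0` of the paths in `G` that start
at `q`. -/
def tangentSpace (G : MatrixLieGroup n 𝕜) (q : G) : Submodule ℝ (Matrix (Fin n) (Fin n) 𝕜) where
  carrier := {v | ∃ γ : ℝ → G, γ 0 = q ∧ HasDerivAt (fun t => toMat (γ t)) v 0}
  zero_mem' := ⟨fun _ => q, rfl, hasDerivAt_const _ _⟩
  add_mem' := by
    rintro v w ⟨γ, hγ, hv⟩ ⟨δ, hδ, hw⟩
    refine ⟨fun t => γ t * (q⁻¹ * δ t), by simp [hγ, hδ], ?_⟩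
    have h := hv.mul (hw.const_mul (toMat q⁻¹))
    rw [hγ, hδ, toMat_inv_mul, mul_one, ← mul_assoc, ← toMat_mul, mul_inv_cancel, toMat_one,
      one_mul] at h
    exact h
  smul_mem' := by
    rintro c v ⟨γ, hγ, hv⟩
    refine ⟨fun t => γ (c * t), by simp [hγ], ?_⟩
    have h1 : HasDerivAt (fun t : ℝ => c * t) c 0 := by
      simpa using (hasDerivAt_id (0 : ℝ)).const_mul c
    have h2 : HasDerivAt (fun t => toMat (γ t)) v ((fun t : ℝ => c * t) 0) := by
      simpa using hv
    exact h2.scomp 0 h1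

/-- The Lie algebra `𝔤 = T_e G`. -/
abbrev lieAlg (G : MatrixLieGroup n 𝕜) : Submodule ℝ (Matrix (Fin n) (Fin n) 𝕜) :=
  tangentSpace G 1

/-- The exponential of an element of the Lie algebra, as an invertible matrix. -/
def expUnit {G : MatrixLieGroup n 𝕜} (X : lieAlg G) : Matrix.GeneralLinearGroup (Fin n) 𝕜 :=
  letI : NormedAlgebra ℚ 𝕜 := NormedAlgebra.restrictScalars ℚ ℝ 𝕜
  (Matrix.isUnit_exp (X : Matrix (Fin n) (Fin n) 𝕜)).unit

theorem expUnit_coe {G : MatrixLieGroup n 𝕜} (X : lieAlg G) :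
    (expUnit X : Matrix (Fin n) (Fin n) 𝕜) = NormedSpace.exp (X : Matrix (Fin n) (Fin n) 𝕜) :=
  rfl

theorem expUnit_mem {G : MatrixLieGroup n 𝕜} (X : lieAlg G) : expUnit X ∈ G := by
  let _ : NormedAlgebra ℚ 𝕜 := NormedAlgebra.restrictScalars ℚ ℝ 𝕜
  obtain ⟨γ, hγ, hX⟩ := X.2
  -- a local logarithm `Y` of the path `γ`, so that `exp (m Y(1/m)) = γ(1/m) ^ m` tends to `exp X`
  have hexp : HasStrictFDerivAt (NormedSpace.exp : Matrix (Fin n) (Fin n) 𝕜 → _)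
      ((ContinuousLinearEquiv.refl ℝ (Matrix (Fin n) (Fin n) 𝕜) :
        Matrix (Fin n) (Fin n) 𝕜 →L[ℝ] Matrix (Fin n) (Fin n) 𝕜)) 0 :=
    hasStrictFDerivAt_exp_zero
  have hL := hexp.to_localInverse
  have hL0 := hexp.localInverse_apply_image
  have hR := hexp.eventually_right_inverse
  set Lg := hexp.localInverse with hLg
  clear_value Lg
  rw [NormedSpace.exp_zero] at hL hL0 hR
  have hγ1 : toMat (γ 0) = 1 := by rw [hγ, toMat_one]
  have hY : HasDerivAt (fun t => Lg (toMat (γ t))) (X : Matrix (Fin n) (Fin n) 𝕜) 0 := by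
    have h := hL.hasFDerivAt
    rw [← hγ1] at h
    exact h.comp_hasDerivAt (0 : ℝ) hX
  have hseq : Tendsto (fun m : ℕ => ((m : ℝ) + 1)⁻¹) atTop (𝓝 0) := by
    simpa using tendsto_one_div_add_atTop_nhds_zero_nat (𝕜 := ℝ)
  have hseq' : Tendsto (fun m : ℕ => ((m : ℝ) + 1)⁻¹) atTop (𝓝[≠] 0) :=
    tendsto_nhdsWithin_iff.2 ⟨hseq, Eventually.of_forall fun m => by
      simp only [mem_compl_iff, mem_singleton_iff, inv_eq_zero]; positivity⟩
  have hlim : Tendsto (fun m : ℕ => (m + 1) • Lg (toMat (γ ((m : ℝ) + 1)⁻¹))) atTop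
      (𝓝 (X : Matrix (Fin n) (Fin n) 𝕜)) := by
    refine (hY.tendsto_slope.comp hseq').congr fun m => ?_
    simp only [Function.comp_apply, slope, sub_zero, inv_inv, hγ1, hL0, vsub_eq_sub]
    rw [← Nat.cast_smul_eq_nsmul ℝ]
    push_cast
    rfl
  have hlim2 := ((NormedSpace.exp_continuous
    (𝔸 := Matrix (Fin n) (Fin n) 𝕜)).continuousAt.tendsto).comp hlim
  have hev : ∀ᶠ m : ℕ in atTop,
      NormedSpace.exp (Lg (toMat (γ ((m : ℝ) + 1)⁻¹))) = toMat (γ ((m : ℝ) + 1)⁻¹) := by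
    have hc : Tendsto (fun t => toMat (γ t)) (𝓝 0) (𝓝 1) := hγ1 ▸ hX.continuousAt.tendsto
    exact (hc.comp hseq).eventually hR
  have hlim3 : Tendsto (fun m : ℕ => ((γ ((m : ℝ) + 1)⁻¹ ^ (m + 1) : G) :
      Matrix.GeneralLinearGroup (Fin n) 𝕜)) atTop (𝓝 (expUnit X)) := by
    refine (Units.isOpenEmbedding_val (R := Matrix (Fin n) (Fin n) 𝕜)).tendsto_nhds_iff.2 ?_
    refine hlim2.congr' ?_
    filter_upwards [hev] with m hm
    refine (NormedSpace.exp_nsmul (m + 1) (Lg (toMat (γ ((m : ℝ) + 1)⁻¹)))).trans ?_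
    refine (congrArg (· ^ (m + 1)) hm).trans ?_
    simp [toMat]
  exact G.isClosed'.mem_of_tendsto hlim3 (Eventually.of_forall fun m =>
    (γ ((m : ℝ) + 1)⁻¹ ^ (m + 1)).2)

/-- The exponential map `𝔤 → G`, which is the matrix exponential. -/
def expG {G : MatrixLieGroup n 𝕜} (X : lieAlg G) : G := ⟨expUnit X, expUnit_mem X⟩

theorem toMat_expG {G : MatrixLieGroup n 𝕜} (X : lieAlg G) :
    toMat (expG X) = NormedSpace.exp (X : Matrix (Fin n) (Fin n) 𝕜) := rfl

/-- The inverse `exp⁻¹ : exp(O) → O` of the exponential map on a set `O` where it is injective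
(the values outside `exp(O)` are irrelevant). -/
def logOn {G : MatrixLieGroup n 𝕜} (O : Set (lieAlg G)) : G → lieAlg G :=
  Function.invFunOn expG O

/-- `exp` restricts to a diffeomorphism from the open set `O ⊆ 𝔤` onto the open set
`exp(O) ⊆ G`. -/
structure IsExpDiffeoOn {G : MatrixLieGroup n 𝕜} (O : Set (lieAlg G)) : Prop where
  isOpen : IsOpen O
  isOpen_image : IsOpen (expG '' O)
  injOn : InjOn expG O
  smooth_exp : ContDiffOn ℝ ∞ (fun X : lieAlg G => toMat (expG X)) O
  smooth_log : SmoothVia (fun p : expG '' O => toMat (p : G)) (fun p => logOn O (p : G))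

/-- `L : T_q G → V` is the derivative of `F : G → V` at `q`:
`L v = d/dt F(γ(t))` at `t = 0` for each path `γ` in `G` with `γ(0) = q`, `γ'(0) = v`. -/
def HasGroupDeriv {G : MatrixLieGroup n 𝕜} {V : Type*} [NormedAddCommGroup V] [NormedSpace ℝ V]
    (F : G → V) (q : G) (L : tangentSpace G q →L[ℝ] V) : Prop :=
  ∀ (γ : ℝ → G) (v : tangentSpace G q), γ 0 = q →
    HasDerivAt (fun t => toMat (γ t)) (v : Matrix (Fin n) (Fin n) 𝕜) 0 →
      HasDerivAt (fun t => F (γ t)) (L v) 0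

open Classical in
/-- The derivative `D F(q) : T_q G → V` (zero if it does not exist). -/
def groupDeriv {G : MatrixLieGroup n 𝕜} {V : Type*} [NormedAddCommGroup V] [NormedSpace ℝ V]
    (F : G → V) (q : G) : tangentSpace G q →L[ℝ] V :=
  if h : ∃ L, HasGroupDeriv F q L then h.choose else 0

/-- The tangent map `T_e Φ_q : 𝔤 → T_q G` of the left translation `Φ_q(p) = q p`, which is
`χ ↦ q χ`. -/
def leftTangent {G : MatrixLieGroup n 𝕜} (q : G) : lieAlg G →L[ℝ] tangentSpace G q :=
  LinearMap.toContinuousLinearMap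
    { toFun := fun χ => ⟨toMat q * (χ : Matrix (Fin n) (Fin n) 𝕜), by
        obtain ⟨γ, hγ, hv⟩ := χ.2
        exact ⟨fun t => q * γ t, by simp [hγ], hv.const_mul (toMat q)⟩⟩
      map_add' := fun χ χ' => Subtype.ext (mul_add _ _ _)
      map_smul' := fun c χ => Subtype.ext (mul_smul_comm c _ _) }

/-- The cotangent left trivialization `T_e^* Φ_q : T_q^* G → 𝔤^*`. -/
def leftTriv {G : MatrixLieGroup n 𝕜} (q : G) (a : StrongDual ℝ (tangentSpace G q)) :
    StrongDual ℝ (lieAlg G) :=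
  a.comp (leftTangent q)

/-- The adjoint action `Ad_g : 𝔤 → 𝔤`, `β ↦ g β g⁻¹`. -/
def Ad {G : MatrixLieGroup n 𝕜} (g : G) : lieAlg G →L[ℝ] lieAlg G :=
  LinearMap.toContinuousLinearMap
    { toFun := fun β => ⟨toMat g * (β : Matrix (Fin n) (Fin n) 𝕜) * toMat g⁻¹, by
        obtain ⟨γ, hγ, hv⟩ := β.2
        exact ⟨fun t => g * γ t * g⁻¹, by simp [hγ],
          (hv.const_mul (toMat g)).mul_const (toMat g⁻¹)⟩⟩
      map_add' := fun β β' => Subtype.ext (by simp [mul_add, add_mul])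
      map_smul' := fun c β => Subtype.ext (by simp) }

/-- The dual map `Ad_g^* : 𝔤^* → 𝔤^*`, `⟨Ad_g^* a, β⟩ = ⟨a, Ad_g β⟩`. -/
def AdDual {G : MatrixLieGroup n 𝕜} (g : G) (a : StrongDual ℝ (lieAlg G)) :
    StrongDual ℝ (lieAlg G) :=
  a.comp (Ad g)

/-- The dual map `(D exp⁻¹(r) ∘ T_e Φ_r)^* : 𝔤^* → 𝔤^*`. -/
def dLogDual {G : MatrixLieGroup n 𝕜} (O : Set (lieAlg G)) (r : G)
    (ζ : StrongDual ℝ (lieAlg G)) : StrongDual ℝ (lieAlg G) :=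
  ζ.comp ((groupDeriv (logOn O) r).comp (leftTangent r))

end Group

/-- The data of a discrete-time optimal control problem on `G × ℝ^{nx}` with controls in
`ℝ^{nu}`: minimize `∑_{t < N} c_t(q_t, x_t, u_t) + c_N(q_N, x_N)` subject to
`q_{t+1} = q_t s_t(q_t, x_t)`, `x_{t+1} = f_t(q_t, x_t, u_t)`, `u_t ∈ U_t` for `t < N`,
`g_t(q_t, x_t) ≤ 0` for `1 ≤ t ≤ N`, and `(q_0, x_0) = (qbar, xbar)`.
Data at other times are irrelevant. -/
structure ControlProblem {n : ℕ} {𝕜 : Type*} [RCLike 𝕜] (G : MatrixLieGroup n 𝕜)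
    (nx nu : ℕ) where
  /-- the horizon -/
  N : ℕ
  /-- the dynamics on the group -/
  s : ℕ → G → Eucl nx → G
  /-- the dynamics on the Euclidean space -/
  f : ℕ → G → Eucl nx → Eucl nu → Eucl nx
  /-- the cost per stage -/
  c : ℕ → G → Eucl nx → Eucl nu → ℝ
  /-- the final cost -/
  cN : G → Eucl nx → ℝ
  /-- the numbers of state constraints -/
  ng : ℕ → ℕ
  /-- the state constraints -/
  g : (t : ℕ) → G → Eucl nx → Fin (ng t) → ℝ
  /-- the feasible control actions -/
  U : ℕ → Set (Eucl nu)
  /-- the initial state in the group -/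
  qbar : G
  /-- the initial state in the Euclidean space -/
  xbar : Eucl nx

namespace ControlProblem

variable {n : ℕ} {𝕜 : Type*} [RCLike 𝕜] {G : MatrixLieGroup n 𝕜} {nx nu : ℕ}

/-- The standing assumptions: positive horizon, smooth data, step maps with values in `exp(O)`
for an open set `O ⊆ 𝔤` on which `exp` is a diffeomorphism, convex sets of controls. -/
structure Standing (P : ControlProblem G nx nu) (O : Set (lieAlg G)) : Prop where
  N_pos : 0 < P.N
  smooth_s : ∀ t < P.N, SmoothVia (fun p : G × Eucl nx => (toMat p.1, p.2))
    (fun p => toMat (P.s t p.1 p.2))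
  smooth_f : ∀ t < P.N, SmoothVia (fun p : G × Eucl nx × Eucl nu => (toMat p.1, p.2))
    (fun p => P.f t p.1 p.2.1 p.2.2)
  smooth_c : ∀ t < P.N, SmoothVia (fun p : G × Eucl nx × Eucl nu => (toMat p.1, p.2))
    (fun p => P.c t p.1 p.2.1 p.2.2)
  smooth_cN : SmoothVia (fun p : G × Eucl nx => (toMat p.1, p.2)) (fun p => P.cN p.1 p.2)
  smooth_g : ∀ t, 1 ≤ t → t ≤ P.N → SmoothVia (fun p : G × Eucl nx => (toMat p.1, p.2))
    (fun p => P.g t p.1 p.2)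
  exp_diffeo : IsExpDiffeoOn O
  step_mem : ∀ t < P.N, ∀ q x, P.s t q x ∈ expG '' O
  convex_U : ∀ t < P.N, Convex ℝ (P.U t)

/-- The constraints of the problem. -/
structure Feasible (P : ControlProblem G nx nu) (q : ℕ → G) (x : ℕ → Eucl nx)
    (u : ℕ → Eucl nu) : Prop where
  init_q : q 0 = P.qbar
  init_x : x 0 = P.xbar
  step_q : ∀ t < P.N, q (t + 1) = q t * P.s t (q t) (x t)
  step_x : ∀ t < P.N, x (t + 1) = P.f t (q t) (x t) (u t)
  control : ∀ t < P.N, u t ∈ P.U t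
  state : ∀ t, 1 ≤ t → t ≤ P.N → ∀ j, P.g t (q t) (x t) j ≤ 0

/-- The performance index. -/
def cost (P : ControlProblem G nx nu) (q : ℕ → G) (x : ℕ → Eucl nx) (u : ℕ → Eucl nu) : ℝ :=
  ∑ t ∈ Finset.range P.N, P.c t (q t) (x t) (u t) + P.cN (q P.N) (x P.N)

/-- `(q, x, u)` is an optimal state-action trajectory. -/
def IsOptimal (P : ControlProblem G nx nu) (q : ℕ → G) (x : ℕ → Eucl nx)
    (u : ℕ → Eucl nu) : Prop :=
  P.Feasible q x u ∧ ∀ q' x' u', P.Feasible q' x' u' → P.cost q x u ≤ P.cost q' x' u'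

/-- The Hamiltonian
`ν c_τ(q, x, u) + ⟨ζ, exp⁻¹(s_τ(q, x))⟩ + ⟨ξ, f_τ(q, x, u)⟩`. -/
def ham (P : ControlProblem G nx nu) (O : Set (lieAlg G)) (ν : ℝ) (τ : ℕ)
    (ζ : StrongDual ℝ (lieAlg G)) (ξ : StrongDual ℝ (Eucl nx)) (q : G) (x : Eucl nx)
    (u : Eucl nu) : ℝ :=
  ν * P.c τ q x u + ζ (logOn O (P.s τ q x)) + ξ (P.f τ q x u)

/-- `D_ζ H`, an element of `𝔤^{**} = 𝔤`. -/
def hamDζ (P : ControlProblem G nx nu) (O : Set (lieAlg G)) (ν : ℝ) (τ : ℕ)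
    (ζ : StrongDual ℝ (lieAlg G)) (ξ : StrongDual ℝ (Eucl nx)) (q : G) (x : Eucl nx)
    (u : Eucl nu) : lieAlg G :=
  fromBidual (fderiv ℝ (fun ζ' => P.ham O ν τ ζ' ξ q x u) ζ)

/-- The covector `ρ = (D exp⁻¹(e^{D_ζ H}) ∘ T_e Φ_{e^{D_ζ H}})^* ζ` in `𝔤^*`. -/
def rho (P : ControlProblem G nx nu) (O : Set (lieAlg G)) (ν : ℝ) (τ : ℕ)
    (ζ : StrongDual ℝ (lieAlg G)) (ξ : StrongDual ℝ (Eucl nx)) (q : G) (x : Eucl nx)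
    (u : Eucl nu) : StrongDual ℝ (lieAlg G) :=
  dLogDual O (expG (P.hamDζ O ν τ ζ ξ q x u)) ζ

/-- `D_ξ H`, an element of `(ℝ^{nx})^{**} = ℝ^{nx}`. -/
def hamDξ (P : ControlProblem G nx nu) (O : Set (lieAlg G)) (ν : ℝ) (τ : ℕ)
    (ζ : StrongDual ℝ (lieAlg G)) (ξ : StrongDual ℝ (Eucl nx)) (q : G) (x : Eucl nx)
    (u : Eucl nu) : Eucl nx :=
  fromBidual (fderiv ℝ (fun ξ' => P.ham O ν τ ζ ξ' q x u) ξ)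

/-- `D_q H`, an element of `T_q^* G`. -/
def hamDq (P : ControlProblem G nx nu) (O : Set (lieAlg G)) (ν : ℝ) (τ : ℕ)
    (ζ : StrongDual ℝ (lieAlg G)) (ξ : StrongDual ℝ (Eucl nx)) (q : G) (x : Eucl nx)
    (u : Eucl nu) : StrongDual ℝ (tangentSpace G q) :=
  groupDeriv (fun q' => P.ham O ν τ ζ ξ q' x u) q

/-- `D_x H`, an element of `(ℝ^{nx})^*`. -/
def hamDx (P : ControlProblem G nx nu) (O : Set (lieAlg G)) (ν : ℝ) (τ : ℕ)
    (ζ : StrongDual ℝ (lieAlg G)) (ξ : StrongDual ℝ (Eucl nx)) (q : G) (x : Eucl nx)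
    (u : Eucl nu) : StrongDual ℝ (Eucl nx) :=
  fderiv ℝ (fun x' => P.ham O ν τ ζ ξ q x' u) x

/-- `D_u H`, an element of `(ℝ^{nu})^*`. -/
def hamDu (P : ControlProblem G nx nu) (O : Set (lieAlg G)) (ν : ℝ) (τ : ℕ)
    (ζ : StrongDual ℝ (lieAlg G)) (ξ : StrongDual ℝ (Eucl nx)) (q : G) (x : Eucl nx)
    (u : Eucl nu) : StrongDual ℝ (Eucl nu) :=
  fderiv ℝ (fun u' => P.ham O ν τ ζ ξ q x u') u

/-- `μ D_q g_t(q, x)`, an element of `T_q^* G`, for a row vector `μ`. -/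
def mulDqg (P : ControlProblem G nx nu) (t : ℕ) (μ : Fin (P.ng t) → ℝ) (q : G) (x : Eucl nx) :
    StrongDual ℝ (tangentSpace G q) :=
  ∑ j, μ j • groupDeriv (fun q' => P.g t q' x j) q

/-- `μ D_x g_t(q, x)`, an element of `(ℝ^{nx})^*`, for a row vector `μ`. -/
def mulDxg (P : ControlProblem G nx nu) (t : ℕ) (μ : Fin (P.ng t) → ℝ) (q : G) (x : Eucl nx) :
    StrongDual ℝ (Eucl nx) :=
  ∑ j, μ j • fderiv ℝ (fun x' => P.g t q x' j) x

end ControlProblem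

end DiscretePMP

end

open DiscretePMP

/-!
The states are functions of the controls, so the problem is to minimize the cost over a convex set
of control sequences under finitely many inequality constraints. The theorem is the Fritz John rule
for this reduced problem, rewritten with adjoint covectors.

* `DiffExtAt.hasDerivAt` is the chain rule along paths in `G × E`: the derivative splits into the
  partial derivatives `groupDeriv` and `fderiv`. All differentiations are along the trajectories of
  the controls `u + ε δ`, with velocities written as `q η`, `η ∈ 𝔤`.
* The derivative of `exp⁻¹` at a point of `exp(O)` is injective, hence `ζ ↦ ρ` is surjective
  (`IsExpDiffeoOn.dLogDual_surjective`). So for arbitrary multipliers `(ν, μ)` the adjoint equations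
  can be solved backwards in time (`Standing.exists_isAdjoint`).
* For a solution of the adjoint equations, the derivative of `ν J + ∑ μ g` in the direction `δ`
  telescopes to `∑ₜ ⟨D_u H, δ_t⟩` (`Standing.hasDerivAt_lagrangian`). Applied to single multipliers,
  this also shows that the derivatives of the cost and of each constraint are linear in `δ`.
* Optimality excludes a feasible direction that decreases the cost and satisfies the linearized
  constraints strictly. Separating the convex set of linearized values from the open negative
  orthant (`exists_nonneg_weights`) gives the multipliers, and their slackness is the value at
  `δ = 0`. Scaling normalizes `ν`.
-/

noncomputable section

namespace DiscretePMP

/-! ### Derivatives along paths in a matrix Lie group -/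

section GroupCalculus

variable {n : ℕ} {𝕜 : Type*} [RCLike 𝕜] {G : MatrixLieGroup n 𝕜}
variable {E V W : Type*} [NormedAddCommGroup E] [NormedSpace ℝ E]
  [NormedAddCommGroup V] [NormedSpace ℝ V] [NormedAddCommGroup W] [NormedSpace ℝ W]

theorem isEmbedding_toMat : IsEmbedding (toMat : G → Matrix (Fin n) (Fin n) 𝕜) :=
  (Units.isOpenEmbedding_val (R := Matrix (Fin n) (Fin n) 𝕜)).isEmbedding.comp
    IsEmbedding.subtypeVal

theorem toMat_mul_inv (q : G) : toMat q * toMat q⁻¹ = 1 := by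
  rw [← toMat_mul, mul_inv_cancel, toMat_one]

theorem continuousAt_of_hasDerivAt_toMat {γ : ℝ → G} {v : Matrix (Fin n) (Fin n) 𝕜} {t : ℝ}
    (h : HasDerivAt (fun t => toMat (γ t)) v t) : ContinuousAt γ t :=
  isEmbedding_toMat.tendsto_nhds_iff.2 h.continuousAt

theorem coe_leftTangent (q : G) (χ : lieAlg G) :
    (leftTangent q χ : Matrix (Fin n) (Fin n) 𝕜) = toMat q * χ := rfl

theorem coe_Ad (g : G) (β : lieAlg G) :
    (Ad g β : Matrix (Fin n) (Fin n) 𝕜) = toMat g * β * toMat g⁻¹ := rfl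

theorem leftTangent_injective (q : G) : Function.Injective (leftTangent q) := by
  intro a b h
  have h' : toMat q * (a : Matrix (Fin n) (Fin n) 𝕜) = toMat q * b := congrArg Subtype.val h
  apply Subtype.ext
  have := congrArg (toMat q⁻¹ * ·) h'
  simpa [← mul_assoc, toMat_inv_mul] using this

/-- A path in `G` that is differentiable at `0` has velocity `q η` there, with `η ∈ 𝔤`. -/
theorem exists_leftTangent {γ : ℝ → G} {v : Matrix (Fin n) (Fin n) 𝕜}
    (h : HasDerivAt (fun t => toMat (γ t)) v 0) :
    ∃ η : lieAlg G, toMat (γ 0) * (η : Matrix (Fin n) (Fin n) 𝕜) = v :=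
  ⟨⟨toMat (γ 0)⁻¹ * v, fun t => (γ 0)⁻¹ * γ t, by simp, h.const_mul (toMat (γ 0)⁻¹)⟩, by
    rw [← mul_assoc, toMat_mul_inv, one_mul]⟩

/-- Left-trivialized product rule: if `γ` and `σ` have velocities `q η` and `r θ` at `q` and
`r`, then `γ σ` has velocity `q r (Ad_{r⁻¹} η + θ)`. -/
theorem hasDerivAt_toMat_mul {γ σ : ℝ → G} {q r : G} {η θ : lieAlg G} (hγ0 : γ 0 = q)
    (hσ0 : σ 0 = r)
    (hγ : HasDerivAt (fun ε => toMat (γ ε)) (leftTangent q η : Matrix (Fin n) (Fin n) 𝕜) 0)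
    (hσ : HasDerivAt (fun ε => toMat (σ ε)) (leftTangent r θ : Matrix (Fin n) (Fin n) 𝕜) 0) :
    HasDerivAt (fun ε => toMat (γ ε * σ ε))
      (leftTangent (q * r) (Ad r⁻¹ η + θ) : Matrix (Fin n) (Fin n) 𝕜) 0 := by
  refine (hγ.mul hσ).congr_deriv ?_
  rw [hγ0, hσ0]
  simp only [coe_leftTangent, Submodule.coe_add, coe_Ad, toMat_mul, inv_inv, mul_add]
  congr 1
  · calc _ = toMat q * 1 * η * toMat r := by rw [mul_one]
      _ = _ := by rw [← toMat_mul_inv r]; simp only [mul_assoc]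
  · simp only [mul_assoc]

theorem HasGroupDeriv.unique {F : G → V} {q : G} {L L' : tangentSpace G q →L[ℝ] V}
    (h : HasGroupDeriv F q L) (h' : HasGroupDeriv F q L') : L = L' := by
  ext v
  obtain ⟨γ, hγ, hv⟩ := v.2
  exact (h γ v hγ hv).unique (h' γ v hγ hv)

theorem HasGroupDeriv.groupDeriv_eq {F : G → V} {q : G} {L : tangentSpace G q →L[ℝ] V}
    (h : HasGroupDeriv F q L) : groupDeriv F q = L := by
  have hex : ∃ L, HasGroupDeriv F q L := ⟨L, h⟩
  rw [groupDeriv, dif_pos hex]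
  exact hex.choose_spec.unique h

theorem hasGroupDeriv_of_eventuallyEq {F : G → V} {q : G} {F' : Matrix (Fin n) (Fin n) 𝕜 → V}
    (hF' : DifferentiableAt ℝ F' (toMat q)) (h : ∀ᶠ p in 𝓝 q, F p = F' (toMat p)) :
    HasGroupDeriv F q ((fderiv ℝ F' (toMat q)).comp (tangentSpace G q).subtypeL) := by
  intro γ v hγ hv
  have hc := (continuousAt_of_hasDerivAt_toMat hv).tendsto
  rw [hγ] at hc
  have hd := hF'.hasFDerivAt
  rw [← hγ] at hd
  have := hd.comp_hasDerivAt (0 : ℝ) hv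
  rw [hγ] at this
  exact this.congr_of_eventuallyEq (hc.eventually h)

/-- `F : G × E → V` agrees near `(q, x)` with a map of the ambient space that is
differentiable there. -/
def DiffExtAt (F : G → E → V) (q : G) (x : E) : Prop :=
  ∃ F' : Matrix (Fin n) (Fin n) 𝕜 × E → V, DifferentiableAt ℝ F' (toMat q, x) ∧
    ∀ᶠ p : G × E in 𝓝 (q, x), F p.1 p.2 = F' (toMat p.1, p.2)

theorem SmoothVia.diffExtAt {F : G → E → V}
    (h : SmoothVia (fun p : G × E => (toMat p.1, p.2)) (fun p => F p.1 p.2)) (q : G) (x : E) :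
    DiffExtAt F q x := by
  obtain ⟨W, hW, hqW, F', hF', hEq⟩ := h (q, x)
  refine ⟨F', (hF'.contDiffAt (hW.mem_nhds hqW)).differentiableAt (by simp), ?_⟩
  have hc : Continuous (fun p : G × E => (toMat p.1, p.2)) :=
    (isEmbedding_toMat.continuous.comp continuous_fst).prodMk continuous_snd
  filter_upwards [hc.continuousAt.preimage_mem_nhds (hW.mem_nhds hqW)] with p hp
  exact hEq p hp

theorem DiffExtAt.add {F F₂ : G → E → V} {q : G} {x : E} (h : DiffExtAt F q x)
    (h₂ : DiffExtAt F₂ q x) : DiffExtAt (fun q x => F q x + F₂ q x) q x := by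
  obtain ⟨F', hF', he⟩ := h
  obtain ⟨F₂', hF₂', he₂⟩ := h₂
  refine ⟨fun p => F' p + F₂' p, hF'.add hF₂', ?_⟩
  filter_upwards [he, he₂] with p h1 h2
  rw [h1, h2]

theorem DiffExtAt.clm {F : G → E → V} {q : G} {x : E} (h : DiffExtAt F q x) (L : V →L[ℝ] W) :
    DiffExtAt (fun q x => L (F q x)) q x := by
  obtain ⟨F', hF', he⟩ := h
  refine ⟨fun p => L (F' p), L.differentiableAt.comp _ hF', ?_⟩
  filter_upwards [he] with p h1
  rw [h1]

/-- A function that ignores the last factor keeps its differentiable extensions. -/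
theorem DiffExtAt.fst {F : G → E → V} {q : G} {x : E} (h : DiffExtAt F q x) (w : W) :
    DiffExtAt (fun q (y : E × W) => F q y.1) q (x, w) := by
  obtain ⟨F', hF', he⟩ := h
  refine ⟨fun p => F' (p.1, p.2.1), ?_, ?_⟩
  · exact DifferentiableAt.comp (toMat q, x, w) (f := fun p :
      Matrix (Fin n) (Fin n) 𝕜 × E × W => (p.1, p.2.1)) hF' (by fun_prop)
  · have hc : ContinuousAt (fun p : G × E × W => (p.1, p.2.1)) (q, x, w) := by fun_prop
    exact hc.eventually he

theorem DiffExtAt.continuousAt {F : G → E → V} {q : G} {x : E} (h : DiffExtAt F q x) :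
    ContinuousAt (fun p : G × E => F p.1 p.2) (q, x) := by
  obtain ⟨F', hF', he⟩ := h
  have hc : ContinuousAt (fun p : G × E => (toMat p.1, p.2)) (q, x) :=
    ((isEmbedding_toMat.continuous.comp continuous_fst).prodMk continuous_snd).continuousAt
  exact (ContinuousAt.comp (f := fun p : G × E => (toMat p.1, p.2)) hF'.continuousAt
    hc).congr (he.mono fun p hp => hp.symm)

theorem DiffExtAt.hasGroupDeriv {F : G → E → V} {q : G} {x : E} (h : DiffExtAt F q x) :
    HasGroupDeriv (fun q' => F q' x) q (groupDeriv (fun q' => F q' x) q) := by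
  obtain ⟨F', hF', he⟩ := h
  have hd : DifferentiableAt ℝ (fun A => F' (A, x)) (toMat q) :=
    DifferentiableAt.comp (toMat q) (f := fun A => (A, x)) hF' (by fun_prop)
  have he' : ∀ᶠ p in 𝓝 q, F p x = F' (toMat p, x) := by
    have hc : ContinuousAt (fun p : G => (p, x)) q := by fun_prop
    exact hc.eventually he
  have := hasGroupDeriv_of_eventuallyEq hd he'
  rwa [this.groupDeriv_eq]

theorem DiffExtAt.differentiableAt {F : G → E → V} {q : G} {x : E} (h : DiffExtAt F q x) :
    DifferentiableAt ℝ (F q) x := by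
  obtain ⟨F', hF', he⟩ := h
  have hd : DifferentiableAt ℝ (fun y => F' (toMat q, y)) x :=
    DifferentiableAt.comp x (f := fun y => (toMat q, y)) hF' (by fun_prop)
  have hc : ContinuousAt (fun y : E => (q, y)) x := by fun_prop
  exact hd.congr_of_eventuallyEq (hc.eventually he)

/-- The chain rule along a path: the derivative of `F` splits into its partial derivatives on
`G` and on `E`. -/
theorem DiffExtAt.hasDerivAt {F : G → E → V} {γ : ℝ → G} {y : ℝ → E} {q : G} {x : E}
    (h : DiffExtAt F q x) (hγ0 : γ 0 = q) (hy0 : y 0 = x) {v : tangentSpace G q} {y' : E}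
    (hγ : HasDerivAt (fun t => toMat (γ t)) (v : Matrix (Fin n) (Fin n) 𝕜) 0)
    (hy : HasDerivAt y y' 0) :
    HasDerivAt (fun t => F (γ t) (y t))
      (groupDeriv (fun q' => F q' x) q v + fderiv ℝ (F q) x y') 0 := by
  have hG := h.hasGroupDeriv γ v hγ0 hγ
  have hE : HasDerivAt (fun t => F q (y t)) (fderiv ℝ (F q) x y') 0 := by
    have := h.differentiableAt.hasFDerivAt
    subst hy0
    exact this.comp_hasDerivAt (0 : ℝ) hy
  obtain ⟨F', hF', he⟩ := h
  subst hγ0 hy0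
  have hcγ : Tendsto γ (𝓝 0) (𝓝 (γ 0)) := (continuousAt_of_hasDerivAt_toMat hγ).tendsto
  have hcy : Tendsto y (𝓝 0) (𝓝 (y 0)) := hy.continuousAt.tendsto
  have hΦ := hF'.hasFDerivAt
  have h1 : HasDerivAt (fun t => F' (toMat (γ t), y t)) _ 0 :=
    hΦ.comp_hasDerivAt (0 : ℝ) (hγ.prodMk hy)
  have h2 : HasDerivAt (fun t => F' (toMat (γ t), y 0)) _ 0 :=
    HasFDerivAt.comp_hasDerivAt (0 : ℝ) (f := fun t => (toMat (γ t), y 0)) hΦ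
      (hγ.prodMk (hasDerivAt_const (0 : ℝ) (y 0)))
  have h3 : HasDerivAt (fun t => F' (toMat (γ 0), y t)) _ 0 :=
    HasFDerivAt.comp_hasDerivAt (0 : ℝ) (f := fun t => (toMat (γ 0), y t)) hΦ
      ((hasDerivAt_const (0 : ℝ) (toMat (γ 0))).prodMk hy)
  have e1 := h1.congr_of_eventuallyEq ((hcγ.prodMk_nhds hcy).eventually he)
  have e2 := h2.congr_of_eventuallyEq
    ((hcγ.prodMk_nhds (tendsto_const_nhds (x := y 0))).eventually he)
  have e3 := h3.congr_of_eventuallyEq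
    (((tendsto_const_nhds (x := γ 0)).prodMk_nhds hcy).eventually he)
  rw [hG.unique e2, hE.unique e3]
  convert e1 using 1
  refine ((fderiv ℝ F' (toMat (γ 0), y 0)).map_add ((v : Matrix (Fin n) (Fin n) 𝕜), (0 : E))
    ((0 : Matrix (Fin n) (Fin n) 𝕜), y')).symm.trans (congrArg _ ?_)
  exact Prod.ext (add_zero _) (zero_add _)

/-- The derivative of a map of two vector variables splits into its partial derivatives. -/
theorem fderiv_prod_apply {Φ : E × W → V} {x : E} {w : W} (h : DifferentiableAt ℝ Φ (x, w))
    (a : E) (b : W) :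
    fderiv ℝ Φ (x, w) (a, b) =
      fderiv ℝ (fun x' => Φ (x', w)) x a + fderiv ℝ (fun w' => Φ (x, w')) w b := by
  have h1 := (h.hasFDerivAt.comp x (f := fun e => (e, w)) (hasFDerivAt_prodMk_left x w)).fderiv
  have h2 := (h.hasFDerivAt.comp w (f := fun e => (x, e)) (hasFDerivAt_prodMk_right x w)).fderiv
  simp only [Function.comp_def] at h1 h2
  rw [h1, h2]
  simp [← map_add]

/-! ### The exponential map and its inverse -/

section Log

variable {O : Set (lieAlg G)}

theorem expG_logOn {r : G} (hr : r ∈ expG '' O) : expG (logOn O r) = r :=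
  Function.invFunOn_eq (by simpa using hr)

theorem logOn_mem {r : G} (hr : r ∈ expG '' O) : logOn O r ∈ O :=
  Function.invFunOn_mem (by simpa using hr)

theorem expG_neg (X : lieAlg G) : expG (-X) = (expG X)⁻¹ := by
  let _ : NormedAlgebra ℚ 𝕜 := NormedAlgebra.restrictScalars ℚ ℝ 𝕜
  apply eq_inv_of_mul_eq_one_left
  apply isEmbedding_toMat.injective
  rw [toMat_mul, toMat_expG, toMat_expG, toMat_one, Submodule.coe_neg,
    ← Matrix.exp_add_of_commute _ _ ((Commute.refl (X : Matrix (Fin n) (Fin n) 𝕜)).neg_left), neg_add_cancel,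
    NormedSpace.exp_zero]

theorem IsExpDiffeoOn.exists_extension (hO : IsExpDiffeoOn O) {r : G} (hr : r ∈ expG '' O) :
    ∃ F' : Matrix (Fin n) (Fin n) 𝕜 → lieAlg G, DifferentiableAt ℝ F' (toMat r) ∧
      ∀ᶠ p in 𝓝 r, logOn O p = F' (toMat p) := by
  obtain ⟨W, hW, hrW, F', hF', hEq⟩ := hO.smooth_log ⟨r, hr⟩
  refine ⟨F', (hF'.contDiffAt (hW.mem_nhds hrW)).differentiableAt (by simp), ?_⟩
  filter_upwards [hO.isOpen_image.mem_nhds hr,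
    isEmbedding_toMat.continuous.continuousAt.preimage_mem_nhds (hW.mem_nhds hrW)] with p h1 h2
  exact hEq ⟨p, h1⟩ h2

theorem IsExpDiffeoOn.hasGroupDeriv_logOn (hO : IsExpDiffeoOn O) {r : G}
    (hr : r ∈ expG '' O) : HasGroupDeriv (logOn O) r (groupDeriv (logOn O) r) := by
  obtain ⟨F', hF', he⟩ := hO.exists_extension hr
  have := hasGroupDeriv_of_eventuallyEq hF' he
  rwa [this.groupDeriv_eq]

theorem IsExpDiffeoOn.diffExtAt_logOn (hO : IsExpDiffeoOn O) {s : G → E → G} {q : G} {x : E}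
    (hs : DiffExtAt (fun q x => toMat (s q x)) q x) (hr : s q x ∈ expG '' O) :
    DiffExtAt (fun q x => logOn O (s q x)) q x := by
  obtain ⟨F', hF', he⟩ := hO.exists_extension hr
  have hc : ContinuousAt (fun p : G × E => s p.1 p.2) (q, x) :=
    isEmbedding_toMat.tendsto_nhds_iff.2 hs.continuousAt
  obtain ⟨S', hS', hes⟩ := hs
  have h0 := hes.self_of_nhds
  simp only at h0
  rw [h0] at hF'
  refine ⟨fun p => F' (S' p), hF'.comp _ hS', ?_⟩
  filter_upwards [hes, hc.eventually he] with p h1 h2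
  rw [h2, h1]

/-- The derivative of `exp⁻¹` is injective, since the derivative of `exp` is a left inverse. -/
theorem IsExpDiffeoOn.groupDeriv_logOn_injective (hO : IsExpDiffeoOn O) {r : G}
    (hr : r ∈ expG '' O) : Function.Injective (groupDeriv (logOn O) r) := by
  rw [injective_iff_map_eq_zero]
  intro v hv
  obtain ⟨γ, hγ, hd⟩ := v.2
  have h1 := hO.hasGroupDeriv_logOn hr γ v hγ hd
  rw [hv] at h1
  have hexp : HasFDerivAt (fun X : lieAlg G => toMat (expG X)) _ (logOn O (γ 0)) :=
    ((hO.smooth_exp.contDiffAt (hO.isOpen.mem_nhds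
      (logOn_mem (hγ ▸ hr)))).differentiableAt (by simp)).hasFDerivAt
  have h2 := hexp.comp_hasDerivAt (0 : ℝ) h1
  rw [map_zero] at h2
  have hc := (continuousAt_of_hasDerivAt_toMat hd).tendsto
  rw [hγ] at hc
  have h3 : HasDerivAt (fun t => toMat (γ t)) 0 0 := by
    refine h2.congr_of_eventuallyEq ?_
    filter_upwards [hc.eventually (hO.isOpen_image.mem_nhds hr)] with t ht
    exact congrArg toMat (expG_logOn ht).symm
  exact Subtype.ext (hd.unique h3)

theorem IsExpDiffeoOn.dLogDual_surjective (hO : IsExpDiffeoOn O) {r : G}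
    (hr : r ∈ expG '' O) : Function.Surjective (dLogDual O r) := by
  intro ρ
  have hinj : Function.Injective
      ((groupDeriv (logOn O) r).comp (leftTangent r) : lieAlg G →ₗ[ℝ] lieAlg G) :=
    (hO.groupDeriv_logOn_injective hr).comp (leftTangent_injective r)
  let e := LinearEquiv.ofInjectiveEndo _ hinj
  refine ⟨ρ.comp (LinearMap.toContinuousLinearMap (e.symm : lieAlg G →ₗ[ℝ] lieAlg G)), ?_⟩
  ext X
  exact congrArg ρ (e.symm_apply_apply X)

end Log

end GroupCalculus

/-! ### Separation and auxiliary facts -/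

/-- Gordan's alternative on a convex set: if no point of `C` makes all the affine functions
`a i + φ i` negative, then a nontrivial nonnegative combination of them is nonnegative on `C`. -/
theorem exists_nonneg_weights {ι V : Type*} [Fintype ι] [AddCommGroup V] [Module ℝ V]
    {C : Set V} (hC : Convex ℝ C) (hne : C.Nonempty) (a : ι → ℝ) (φ : ι → V →ₗ[ℝ] ℝ)
    (h : ∀ v ∈ C, ∃ i, 0 ≤ a i + φ i v) :
    ∃ l : ι → ℝ, (∀ i, 0 ≤ l i) ∧ l ≠ 0 ∧ ∀ v ∈ C, 0 ≤ ∑ i, l i * (a i + φ i v) := by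
  classical
  let Nset : Set (ι → ℝ) := {b | ∀ i, b i < 0}
  have hNopen : IsOpen Nset := by
    simp only [Nset, ofPred_forall]
    exact isOpen_iInter_of_finite fun i => isOpen_lt (continuous_apply i) continuous_const
  have hNconv : Convex ℝ Nset := by
    intro b hb b' hb' s t hs ht hst i
    have h1 := hb i
    have h2 := hb' i
    simp only [Pi.add_apply, Pi.smul_apply, smul_eq_mul]
    rcases hs.eq_or_lt with rfl | hs
    · have : t = 1 := by linarith
      subst this; simpa using h2
    · nlinarith
  have hAconv : Convex ℝ ((fun v i => a i + φ i v) '' C) := by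
    rintro _ ⟨v, hv, rfl⟩ _ ⟨w, hw, rfl⟩ s t hs ht hst
    refine ⟨s • v + t • w, hC hv hw hs ht hst, funext fun i => ?_⟩
    simp only [map_add, map_smul, Pi.add_apply, Pi.smul_apply, smul_eq_mul]
    linear_combination -(a i) * hst
  have hdisj : Disjoint Nset ((fun v i => a i + φ i v) '' C) := by
    rw [Set.disjoint_left]
    rintro _ hb ⟨v, hv, rfl⟩
    obtain ⟨i, hi⟩ := h v hv
    exact absurd (hb i) (not_lt.2 hi)
  obtain ⟨f, c, hf, hc⟩ := geometric_hahn_banach_open hNconv hNopen hAconv hdisj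
  have hsum : ∀ b : ι → ℝ, f b = ∑ i, f (Pi.single i 1) * b i := by
    intro b
    conv_lhs => rw [← Finset.univ_sum_single b, map_sum]
    refine Finset.sum_congr rfl fun i _ => ?_
    have : Pi.single i (b i) = b i • (Pi.single i 1 : ι → ℝ) := by
      rw [← Pi.single_smul, smul_eq_mul, mul_one]
    rw [this, map_smul, smul_eq_mul, mul_comm]
  -- `f ≤ c` on the closed negative orthant, a cone, whence `f ≤ 0` there and `0 ≤ c`
  have hle : ∀ b : ι → ℝ, (∀ i, b i ≤ 0) → f b ≤ c := by
    intro b hb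
    have ht : Tendsto (fun ε : ℝ => f (b - ε • (1 : ι → ℝ))) (𝓝[>] 0) (𝓝 (f b)) := by
      have : Continuous (fun ε : ℝ => f (b - ε • (1 : ι → ℝ))) := by fun_prop
      simpa using (this.tendsto 0).mono_left nhdsWithin_le_nhds
    refine le_of_tendsto ht ?_
    filter_upwards [self_mem_nhdsWithin] with ε hε
    refine (hf _ fun i => ?_).le
    have := hb i
    simp only [Pi.sub_apply, Pi.smul_apply, Pi.one_apply, smul_eq_mul, mul_one]
    linarith [mem_Ioi.1 hε]
  have hc0 : 0 ≤ c := by simpa using hle 0 (by simp)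
  refine ⟨fun i => f (Pi.single i 1), fun i => ?_, fun h0 => ?_, ?_⟩
  · by_contra! hneg
    obtain ⟨k, hk⟩ := exists_nat_gt (c / -f (Pi.single i 1))
    have h1 := hle (-(k : ℝ) • Pi.single i 1) fun j => by
      by_cases hj : j = i
      · subst hj; simp
      · simp [hj]
    rw [map_smul, smul_eq_mul] at h1
    rw [div_lt_iff₀ (by linarith)] at hk
    linarith
  · obtain ⟨v, hv⟩ := hne
    have h1 := hf (fun _ => -1) fun i => by norm_num
    have h2 := hc _ ⟨v, hv, rfl⟩
    have hz : ∀ b, f b = 0 := fun b => by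
      rw [hsum b]; exact Finset.sum_eq_zero fun i _ => by
        rw [show f (Pi.single i 1) = 0 from congrFun h0 i, zero_mul]
    rw [hz] at h1 h2
    linarith
  · intro v hv
    rw [← hsum]
    exact hc0.trans (hc _ ⟨v, hv, rfl⟩)

theorem eventually_neg_of_hasDerivAt {h : ℝ → ℝ} {h' : ℝ} (hd : HasDerivAt h h' 0)
    (h0 : h 0 ≤ 0) (hneg : h 0 + h' < 0) : ∀ᶠ ε in 𝓝[>] (0 : ℝ), h ε < 0 := by
  rcases h0.eq_or_lt with h0 | h0
  · rw [h0, zero_add] at hneg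
    have := (hasDerivAt_iff_tendsto_slope.1 hd).mono_left
      (nhdsWithin_mono (0 : ℝ) fun x (hx : 0 < x) => hx.ne')
    filter_upwards [this.eventually (gt_mem_nhds hneg), self_mem_nhdsWithin] with ε h1 h2
    rw [slope_def_field, h0, sub_zero, sub_zero, div_lt_iff₀ h2, zero_mul] at h1
    exact h1
  · exact (hd.continuousAt.eventually (gt_mem_nhds h0)).filter_mono nhdsWithin_le_nhds

/-- A recursion backwards in time from a terminal value at `N - 1`. -/
theorem exists_backward {X : Type*} (N : ℕ) (a : X) (F : ℕ → X → X) :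
    ∃ p : ℕ → X, p (N - 1) = a ∧ ∀ t, 1 ≤ t → t < N → p (t - 1) = F t (p t) := by
  let r : ℕ → X := Nat.rec a fun k y => F (N - 1 - k) y
  refine ⟨fun t => r (N - 1 - t), by simp [r], fun t h1 h2 => ?_⟩
  have : N - 1 - (t - 1) = (N - 1 - t) + 1 := by omega
  simp only [this]
  change F (N - 1 - (N - 1 - t)) _ = _
  rw [show N - 1 - (N - 1 - t) = t by omega]

/-! ### The Hamiltonian and one step of the dynamics -/

theorem fromBidual_fderiv_eval {E : Type*} [NormedAddCommGroup E] [NormedSpace ℝ E]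
    [FiniteDimensional ℝ E] (a b : ℝ) (X : E) (φ₀ : StrongDual ℝ E) :
    fromBidual (fderiv ℝ (fun φ : StrongDual ℝ E => a + φ X + b) φ₀) = X := by
  have h : HasFDerivAt (fun φ : StrongDual ℝ E => a + φ X + b)
      (ContinuousLinearMap.apply ℝ ℝ X) φ₀ :=
    HasFDerivAt.add_const b
      (((ContinuousLinearMap.apply ℝ ℝ X).hasFDerivAt (x := φ₀)).const_add a)
  rw [h.fderiv, fromBidual, LinearEquiv.symm_apply_eq]
  ext φ
  simp

namespace ControlProblem

variable {n : ℕ} {𝕜 : Type*} [RCLike 𝕜] {G : MatrixLieGroup n 𝕜} {nx nu : ℕ}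
variable {P : ControlProblem G nx nu} {O : Set (lieAlg G)}

theorem hamDζ_eq (ν : ℝ) (t : ℕ) (ζ : StrongDual ℝ (lieAlg G)) (ξ : StrongDual ℝ (Eucl nx))
    (q : G) (x : Eucl nx) (u : Eucl nu) :
    P.hamDζ O ν t ζ ξ q x u = logOn O (P.s t q x) :=
  fromBidual_fderiv_eval (ν * P.c t q x u) (ξ (P.f t q x u)) (logOn O (P.s t q x)) ζ

theorem hamDξ_eq (ν : ℝ) (t : ℕ) (ζ : StrongDual ℝ (lieAlg G)) (ξ : StrongDual ℝ (Eucl nx))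
    (q : G) (x : Eucl nx) (u : Eucl nu) :
    P.hamDξ O ν t ζ ξ q x u = P.f t q x u := by
  have h := fromBidual_fderiv_eval (ν * P.c t q x u + ζ (logOn O (P.s t q x))) 0
    (P.f t q x u) ξ
  simp only [add_zero] at h
  exact h

namespace Standing

variable (hP : P.Standing O) {t : ℕ}
include hP

theorem expG_hamDζ (ht : t < P.N) (ν : ℝ) (ζ : StrongDual ℝ (lieAlg G))
    (ξ : StrongDual ℝ (Eucl nx)) (q : G) (x : Eucl nx) (u : Eucl nu) :
    expG (P.hamDζ O ν t ζ ξ q x u) = P.s t q x := by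
  rw [hamDζ_eq, expG_logOn (hP.step_mem t ht q x)]

theorem rho_eq (ht : t < P.N) (ν : ℝ) (ζ : StrongDual ℝ (lieAlg G))
    (ξ : StrongDual ℝ (Eucl nx)) (q : G) (x : Eucl nx) (u : Eucl nu) :
    P.rho O ν t ζ ξ q x u = dLogDual O (P.s t q x) ζ := by
  rw [rho, hP.expG_hamDζ ht]

theorem diffExtAt_s (ht : t < P.N) (q : G) (x : Eucl nx) :
    DiffExtAt (fun q x => toMat (P.s t q x)) q x :=
  SmoothVia.diffExtAt (F := fun q x => toMat (P.s t q x)) (hP.smooth_s t ht) q x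

theorem diffExtAt_f (ht : t < P.N) (q : G) (x : Eucl nx) (u : Eucl nu) :
    DiffExtAt (fun q (p : Eucl nx × Eucl nu) => P.f t q p.1 p.2) q (x, u) :=
  SmoothVia.diffExtAt (F := fun q (p : Eucl nx × Eucl nu) => P.f t q p.1 p.2)
    (hP.smooth_f t ht) q (x, u)

theorem diffExtAt_c (ht : t < P.N) (q : G) (x : Eucl nx) (u : Eucl nu) :
    DiffExtAt (fun q (p : Eucl nx × Eucl nu) => P.c t q p.1 p.2) q (x, u) :=
  SmoothVia.diffExtAt (F := fun q (p : Eucl nx × Eucl nu) => P.c t q p.1 p.2)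
    (hP.smooth_c t ht) q (x, u)

theorem diffExtAt_cN (q : G) (x : Eucl nx) : DiffExtAt P.cN q x :=
  hP.smooth_cN.diffExtAt q x

theorem diffExtAt_g (h1 : 1 ≤ t) (ht : t ≤ P.N) (q : G) (x : Eucl nx) (j : Fin (P.ng t)) :
    DiffExtAt (fun q x => P.g t q x j) q x :=
  ((hP.smooth_g t h1 ht).diffExtAt q x).clm
    (ContinuousLinearMap.proj (R := ℝ) (φ := fun _ : Fin (P.ng t) => ℝ) j)

theorem diffExtAt_ham (ht : t < P.N) (ν : ℝ) (ζ : StrongDual ℝ (lieAlg G))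
    (ξ : StrongDual ℝ (Eucl nx)) (q : G) (x : Eucl nx) (u : Eucl nu) :
    DiffExtAt (fun q (p : Eucl nx × Eucl nu) => P.ham O ν t ζ ξ q p.1 p.2) q (x, u) :=
  ((((hP.diffExtAt_c ht q x u).clm (ν • ContinuousLinearMap.id ℝ ℝ)).add
    (((hP.exp_diffeo.diffExtAt_logOn (hP.diffExtAt_s ht q x)
      (hP.step_mem t ht q x)).clm ζ).fst u)).add ((hP.diffExtAt_f ht q x u).clm ξ))

section Paths

variable {γ : ℝ → G} {y : ℝ → Eucl nx} {w : ℝ → Eucl nu} {q : G} {x : Eucl nx} {u : Eucl nu}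
  {η : lieAlg G} {y' : Eucl nx} {w' : Eucl nu}
  (hγ0 : γ 0 = q) (hy0 : y 0 = x) (hw0 : w 0 = u)
  (hγ : HasDerivAt (fun ε => toMat (γ ε)) (leftTangent q η : Matrix (Fin n) (Fin n) 𝕜) 0)
  (hy : HasDerivAt y y' 0) (hw : HasDerivAt w w' 0)
include hγ0 hy0 hγ hy

theorem hasDerivAt_constraints (h1 : 1 ≤ t) (ht : t ≤ P.N) (μ : Fin (P.ng t) → ℝ) :
    HasDerivAt (fun ε => ∑ j, μ j * P.g t (γ ε) (y ε) j)
      (leftTriv q (P.mulDqg t μ q x) η + P.mulDxg t μ q x y') 0 := by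
  have h := HasDerivAt.fun_sum (u := Finset.univ) fun j _ =>
    ((hP.diffExtAt_g h1 ht q x j).hasDerivAt hγ0 hy0 hγ hy).const_mul (μ j)
  refine h.congr_deriv ?_
  simp [leftTriv, mulDqg, mulDxg, mul_add, Finset.sum_add_distrib]

theorem exists_hasDerivAt_step_group (ht : t < P.N) :
    ∃ θ : lieAlg G, HasDerivAt (fun ε => toMat (P.s t (γ ε) (y ε)))
      (leftTangent (P.s t q x) θ : Matrix (Fin n) (Fin n) 𝕜) 0 := by
  have h := (hP.diffExtAt_s ht q x).hasDerivAt hγ0 hy0 hγ hy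
  obtain ⟨θ, hθ⟩ := exists_leftTangent (γ := fun ε => P.s t (γ ε) (y ε)) h
  refine ⟨θ, ?_⟩
  rw [hγ0, hy0] at hθ
  rw [coe_leftTangent, hθ]
  exact h

include hw0 hw

theorem hasDerivAt_ham (ht : t < P.N) (ν : ℝ) (ζ : StrongDual ℝ (lieAlg G))
    (ξ : StrongDual ℝ (Eucl nx)) :
    HasDerivAt (fun ε => P.ham O ν t ζ ξ (γ ε) (y ε) (w ε))
      (leftTriv q (P.hamDq O ν t ζ ξ q x u) η + P.hamDx O ν t ζ ξ q x u y' +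
        P.hamDu O ν t ζ ξ q x u w') 0 := by
  have hd := hP.diffExtAt_ham ht ν ζ ξ q x u
  have h := hd.hasDerivAt (y := fun ε => (y ε, w ε)) hγ0 (by rw [hy0, hw0]) hγ (hy.prodMk hw)
  refine h.congr_deriv ?_
  rw [fderiv_prod_apply hd.differentiableAt, add_assoc]
  rfl

/-- One step of the telescoping sum: the derivative of the stage cost is that of the Hamiltonian
minus the pairing of the covectors with the velocity of the next state. -/
theorem hasDerivAt_stage_cost (ht : t < P.N) {η₁ : lieAlg G} {y₁ : Eucl nx}
    (hγ₁ : HasDerivAt (fun ε => toMat (γ ε * P.s t (γ ε) (y ε)))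
      (leftTangent (q * P.s t q x) η₁ : Matrix (Fin n) (Fin n) 𝕜) 0)
    (hy₁ : HasDerivAt (fun ε => P.f t (γ ε) (y ε) (w ε)) y₁ 0)
    (ν : ℝ) (ζ : StrongDual ℝ (lieAlg G)) (ξ : StrongDual ℝ (Eucl nx)) :
    HasDerivAt (fun ε => ν * P.c t (γ ε) (y ε) (w ε))
      (AdDual (P.s t q x)⁻¹ (dLogDual O (P.s t q x) ζ) η +
        leftTriv q (P.hamDq O ν t ζ ξ q x u) η + P.hamDx O ν t ζ ξ q x u y' +
        P.hamDu O ν t ζ ξ q x u w' - (dLogDual O (P.s t q x) ζ η₁ + ξ y₁)) 0 := by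
  obtain ⟨θ, hθ⟩ := hP.exists_hasDerivAt_step_group hγ0 hy0 hγ hy ht
  have hnext := hasDerivAt_toMat_mul (σ := fun ε => P.s t (γ ε) (y ε)) hγ0 (by rw [hγ0, hy0])
    hγ hθ
  have hη₁ : η₁ = Ad (P.s t q x)⁻¹ η + θ :=
    leftTangent_injective _ (Subtype.ext (hγ₁.unique hnext))
  have hlog : HasDerivAt (fun ε => ζ (logOn O (P.s t (γ ε) (y ε))))
      (dLogDual O (P.s t q x) ζ θ) 0 :=
    ζ.hasFDerivAt.comp_hasDerivAt (0 : ℝ)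
      (hP.exp_diffeo.hasGroupDeriv_logOn (hP.step_mem t ht q x) _ _ (by rw [hγ0, hy0]) hθ)
  have hf := ξ.hasFDerivAt.comp_hasDerivAt (0 : ℝ) hy₁
  have hham := hP.hasDerivAt_ham hγ0 hy0 hw0 hγ hy hw ht ν ζ ξ
  refine (((hham.sub hlog).sub hf).congr_deriv ?_).congr_of_eventuallyEq
    (Eventually.of_forall fun ε => ?_)
  · rw [hη₁, map_add, AdDual, ContinuousLinearMap.comp_apply]
    ring
  · simp only [ham, Pi.sub_apply, Function.comp_apply]
    ring

end Paths

end Standing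

/-! ### Adjoint covectors and the derivative of the Lagrangian -/

variable (P) in
/-- The trajectory produced by a sequence of controls, ignoring the constraints. -/
def flow (v : ℕ → Eucl nu) : ℕ → G × Eucl nx
  | 0 => (P.qbar, P.xbar)
  | t + 1 => ((flow v t).1 * P.s t (flow v t).1 (flow v t).2,
      P.f t (flow v t).1 (flow v t).2 (v t))

theorem Feasible.flow_eq {q : ℕ → G} {x : ℕ → Eucl nx} {u : ℕ → Eucl nu}
    (h : P.Feasible q x u) : ∀ t ≤ P.N, P.flow u t = (q t, x t) := by
  intro t
  induction t with
  | zero => intro _; rw [flow, h.init_q, h.init_x]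
  | succ t ih =>
    intro ht
    rw [flow, ih (by omega), h.step_q t (by omega), h.step_x t (by omega)]

/-- The adjoint equations and the transversality conditions along `(q, x, u)`. -/
structure IsAdjoint (P : ControlProblem G nx nu) (O : Set (lieAlg G)) (q : ℕ → G)
    (x : ℕ → Eucl nx) (u : ℕ → Eucl nu) (ν : ℝ) (μ : (t : ℕ) → Fin (P.ng t) → ℝ)
    (ζ : ℕ → StrongDual ℝ (lieAlg G)) (ξ : ℕ → StrongDual ℝ (Eucl nx)) : Prop where
  rho_step : ∀ t, 1 ≤ t → t < P.N →
    dLogDual O (P.s (t - 1) (q (t - 1)) (x (t - 1))) (ζ (t - 1)) =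
      AdDual (P.s t (q t) (x t))⁻¹ (dLogDual O (P.s t (q t) (x t)) (ζ t)) +
        leftTriv (q t) (P.hamDq O ν t (ζ t) (ξ t) (q t) (x t) (u t) +
          P.mulDqg t (μ t) (q t) (x t))
  xi_step : ∀ t, 1 ≤ t → t < P.N →
    ξ (t - 1) = P.hamDx O ν t (ζ t) (ξ t) (q t) (x t) (u t) + P.mulDxg t (μ t) (q t) (x t)
  rho_last : dLogDual O (P.s (P.N - 1) (q (P.N - 1)) (x (P.N - 1))) (ζ (P.N - 1)) =
    leftTriv (q P.N) (ν • groupDeriv (fun q' => P.cN q' (x P.N)) (q P.N) +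
      P.mulDqg P.N (μ P.N) (q P.N) (x P.N))
  xi_last : ξ (P.N - 1) = ν • fderiv ℝ (fun x' => P.cN (q P.N) x') (x P.N) +
    P.mulDxg P.N (μ P.N) (q P.N) (x P.N)

theorem Standing.exists_isAdjoint (hP : P.Standing O) (q : ℕ → G) (x : ℕ → Eucl nx)
    (u : ℕ → Eucl nu) (ν : ℝ) (μ : (t : ℕ) → Fin (P.ng t) → ℝ) :
    ∃ ζ ξ, IsAdjoint P O q x u ν μ ζ ξ := by
  have hsurj : ∀ t, ∃ S : StrongDual ℝ (lieAlg G) → StrongDual ℝ (lieAlg G),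
      t < P.N → ∀ ρ, dLogDual O (P.s t (q t) (x t)) (S ρ) = ρ := by
    intro t
    by_cases ht : t < P.N
    · choose S hS using hP.exp_diffeo.dLogDual_surjective (hP.step_mem t ht (q t) (x t))
      exact ⟨S, fun _ => hS⟩
    · exact ⟨id, fun h => absurd h ht⟩
  choose S hS using hsurj
  obtain ⟨p, hlast, hstep⟩ := exists_backward P.N
    (S (P.N - 1) (leftTriv (q P.N) (ν • groupDeriv (fun q' => P.cN q' (x P.N)) (q P.N) +
      P.mulDqg P.N (μ P.N) (q P.N) (x P.N))),
      ν • fderiv ℝ (fun x' => P.cN (q P.N) x') (x P.N) +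
        P.mulDxg P.N (μ P.N) (q P.N) (x P.N))
    (fun t z => (S (t - 1)
      (AdDual (P.s t (q t) (x t))⁻¹ (dLogDual O (P.s t (q t) (x t)) z.1) +
        leftTriv (q t) (P.hamDq O ν t z.1 z.2 (q t) (x t) (u t) +
          P.mulDqg t (μ t) (q t) (x t))),
      P.hamDx O ν t z.1 z.2 (q t) (x t) (u t) + P.mulDxg t (μ t) (q t) (x t)))
  have hN := hP.N_pos
  refine ⟨fun t => (p t).1, fun t => (p t).2, ?_, ?_, ?_, ?_⟩
  · intro t h1 ht
    simp only [hstep t h1 ht]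
    exact hS _ (by omega) _
  · intro t h1 ht
    simp only [hstep t h1 ht]
  · simp only [hlast]
    exact hS _ (by omega) _
  · simp only [hlast]

section Variation

variable (hP : P.Standing O) {q : ℕ → G} {x : ℕ → Eucl nx} {u : ℕ → Eucl nu}
  (hF : P.Feasible q x u) (δ : ℕ → Eucl nu)
include hP hF

theorem Standing.exists_hasDerivAt_flow {t : ℕ} (ht : t ≤ P.N) :
    ∃ (η : lieAlg G) (y' : Eucl nx),
      HasDerivAt (fun ε : ℝ => toMat (P.flow (u + ε • δ) t).1)
        (leftTangent (q t) η : Matrix (Fin n) (Fin n) 𝕜) 0 ∧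
      HasDerivAt (fun ε : ℝ => (P.flow (u + ε • δ) t).2) y' 0 := by
  have h0 : ∀ t ≤ P.N, P.flow (u + (0 : ℝ) • δ) t = (q t, x t) := by
    simpa using hF.flow_eq
  induction t with
  | zero =>
    refine ⟨0, 0, ?_, hasDerivAt_const (0 : ℝ) P.xbar⟩
    rw [map_zero]
    exact hasDerivAt_const (0 : ℝ) (toMat P.qbar)
  | succ t ih =>
    obtain ⟨η, y', hη, hy'⟩ := ih (by omega)
    have hq0 := congrArg Prod.fst (h0 t (by omega))
    have hx0 := congrArg Prod.snd (h0 t (by omega))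
    obtain ⟨θ, hθ⟩ := hP.exists_hasDerivAt_step_group (t := t)
      (γ := fun ε : ℝ => (P.flow (u + ε • δ) t).1) (y := fun ε : ℝ => (P.flow (u + ε • δ) t).2)
      hq0 hx0 hη hy' (by omega)
    have h1 := hasDerivAt_toMat_mul (γ := fun ε : ℝ => (P.flow (u + ε • δ) t).1)
      (σ := fun ε : ℝ => P.s t (P.flow (u + ε • δ) t).1 (P.flow (u + ε • δ) t).2)
      hq0 (by rw [hq0, hx0]) hη hθ
    rw [← hF.step_q t (by omega)] at h1
    have hw : HasDerivAt (fun ε : ℝ => u t + ε • δ t) (δ t) 0 := by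
      simpa using ((hasDerivAt_id (0 : ℝ)).smul_const (δ t)).const_add (u t)
    have h2 := (hP.diffExtAt_f (t := t) (by omega) (q t) (x t) (u t)).hasDerivAt
      (γ := fun ε : ℝ => (P.flow (u + ε • δ) t).1)
      (y := fun ε : ℝ => ((P.flow (u + ε • δ) t).2, u t + ε • δ t)) hq0
      (by simpa using hx0) hη (hy'.prodMk hw)
    exact ⟨_, _, h1, h2⟩

/-- If the covectors solve the adjoint equations, then the derivative of the Lagrangian along a
variation `u + ε δ` of the controls is `∑ₜ ⟨D_u H, δ_t⟩`: the other terms telescope. -/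
theorem Standing.hasDerivAt_lagrangian {ν : ℝ} {μ : (t : ℕ) → Fin (P.ng t) → ℝ}
    {ζ : ℕ → StrongDual ℝ (lieAlg G)} {ξ : ℕ → StrongDual ℝ (Eucl nx)}
    (hadj : IsAdjoint P O q x u ν μ ζ ξ) :
    HasDerivAt (fun ε : ℝ =>
        ν * P.cost (fun t => (P.flow (u + ε • δ) t).1) (fun t => (P.flow (u + ε • δ) t).2)
          (u + ε • δ) +
        ∑ t ∈ Finset.Icc 1 P.N, ∑ j, μ t j *
          P.g t (P.flow (u + ε • δ) t).1 (P.flow (u + ε • δ) t).2 j)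
      (∑ t ∈ Finset.range P.N, P.hamDu O ν t (ζ t) (ξ t) (q t) (x t) (u t) (δ t)) 0 := by
  have h0 : ∀ t ≤ P.N, P.flow (u + (0 : ℝ) • δ) t = (q t, x t) := by
    simpa using hF.flow_eq
  have hq0 : ∀ t ≤ P.N, (P.flow (u + (0 : ℝ) • δ) t).1 = q t :=
    fun t ht => congrArg Prod.fst (h0 t ht)
  have hx0 : ∀ t ≤ P.N, (P.flow (u + (0 : ℝ) • δ) t).2 = x t :=
    fun t ht => congrArg Prod.snd (h0 t ht)
  have hder : ∀ t, ∃ (η : lieAlg G) (y' : Eucl nx), t ≤ P.N →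
      HasDerivAt (fun ε : ℝ => toMat (P.flow (u + ε • δ) t).1)
        (leftTangent (q t) η : Matrix (Fin n) (Fin n) 𝕜) 0 ∧
      HasDerivAt (fun ε : ℝ => (P.flow (u + ε • δ) t).2) y' 0 := by
    intro t
    by_cases ht : t ≤ P.N
    · obtain ⟨η, y', h⟩ := hP.exists_hasDerivAt_flow hF δ ht
      exact ⟨η, y', fun _ => h⟩
    · exact ⟨0, 0, fun h => absurd h ht⟩
  choose η y' hd using hder
  have hw : ∀ t, HasDerivAt (fun ε : ℝ => (u + ε • δ) t) (δ t) 0 := fun t => by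
    simpa using ((hasDerivAt_id (0 : ℝ)).smul_const (δ t)).const_add (u t)
  have hstage : ∀ t (ht : t < P.N), HasDerivAt (fun ε : ℝ =>
      ν * P.c t (P.flow (u + ε • δ) t).1 (P.flow (u + ε • δ) t).2 ((u + ε • δ) t)) _ 0 :=
    fun t ht => hP.hasDerivAt_stage_cost (t := t) (u := u t)
      (y := fun ε : ℝ => (P.flow (u + ε • δ) t).2) (w := fun ε : ℝ => (u + ε • δ) t) (γ := fun ε : ℝ => (P.flow (u + ε • δ) t).1)
      (hq0 t ht.le) (hx0 t ht.le) (by simp) (hd t ht.le).1 (hd t ht.le).2 (hw t) ht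
      (η₁ := η (t + 1)) (y₁ := y' (t + 1))
      (by rw [← hF.step_q t ht]; exact (hd (t + 1) ht).1) (hd (t + 1) ht).2 ν (ζ t) (ξ t)
  have hcon : ∀ t (h1 : 1 ≤ t) (ht : t ≤ P.N), HasDerivAt (fun ε : ℝ => ∑ j, μ t j *
      P.g t (P.flow (u + ε • δ) t).1 (P.flow (u + ε • δ) t).2 j) _ 0 :=
    fun t h1 ht => hP.hasDerivAt_constraints
      (y := fun ε : ℝ => (P.flow (u + ε • δ) t).2) (γ := fun ε : ℝ => (P.flow (u + ε • δ) t).1)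
      (hq0 t ht) (hx0 t ht) (hd t ht).1 (hd t ht).2 h1 ht (μ t)
  have hη0 : η 0 = 0 := by
    refine leftTangent_injective (q 0) (Subtype.ext ?_)
    rw [map_zero]
    exact (hd 0 (Nat.zero_le _)).1.unique (hasDerivAt_const (0 : ℝ) (toMat P.qbar))
  have hy0 : y' 0 = 0 := (hd 0 (Nat.zero_le _)).2.unique (hasDerivAt_const (0 : ℝ) P.xbar)
  -- the sums up to time `k` leave the boundary term at time `k + 1`
  have hpartial : ∀ k < P.N, HasDerivAt (fun ε : ℝ =>
      ∑ t ∈ Finset.range (k + 1), ν * P.c t (P.flow (u + ε • δ) t).1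
          (P.flow (u + ε • δ) t).2 ((u + ε • δ) t) +
        ∑ t ∈ Finset.Icc 1 k, ∑ j, μ t j *
          P.g t (P.flow (u + ε • δ) t).1 (P.flow (u + ε • δ) t).2 j)
      (∑ t ∈ Finset.range (k + 1), P.hamDu O ν t (ζ t) (ξ t) (q t) (x t) (u t) (δ t) -
        (dLogDual O (P.s k (q k) (x k)) (ζ k) (η (k + 1)) + ξ k (y' (k + 1)))) 0 := by
    intro k
    induction k with
    | zero =>
      intro hk
      refine ((hstage 0 hk).congr_deriv ?_).congr_of_eventuallyEq
        (Eventually.of_forall fun ε => ?_)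
      · simp [hη0, hy0]
      · simp
    | succ k ih =>
      intro hk
      refine (((ih (by omega)).add ((hstage (k + 1) hk).add
        (hcon (k + 1) (by omega) hk.le))).congr_deriv ?_).congr_of_eventuallyEq
        (Eventually.of_forall fun ε => ?_)
      · have e1 := hadj.rho_step (k + 1) (by omega) hk
        have e2 := hadj.xi_step (k + 1) (by omega) hk
        rw [Nat.add_sub_cancel] at e1 e2
        rw [e1, e2, Finset.sum_range_succ _ (k + 1)]
        simp only [leftTriv, add_apply, ContinuousLinearMap.comp_apply]
        ring
      · simp only [Pi.add_apply]
        rw [Finset.sum_range_succ _ (k + 1), Finset.sum_Icc_succ_top (by omega)]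
        ring
  have hN := hP.N_pos
  have hfin := (hP.diffExtAt_cN (q P.N) (x P.N)).hasDerivAt
    (γ := fun ε : ℝ => (P.flow (u + ε • δ) P.N).1)
    (y := fun ε : ℝ => (P.flow (u + ε • δ) P.N).2) (hq0 _ le_rfl) (hx0 _ le_rfl)
    (hd _ le_rfl).1 (hd _ le_rfl).2
  obtain ⟨k, hk⟩ : ∃ k, P.N = k + 1 := ⟨P.N - 1, by omega⟩
  refine (((hpartial k (by omega)).add ((hfin.const_mul ν).add
    (hcon P.N (by omega) le_rfl))).congr_deriv ?_).congr_of_eventuallyEq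
    (Eventually.of_forall fun ε => ?_)
  · have e1 := hadj.rho_last
    have e2 := hadj.xi_last
    have hk' : P.N - 1 = k := by omega
    rw [hk'] at e1 e2
    rw [e1, e2, ← hk]
    simp only [leftTriv, add_apply, ContinuousLinearMap.comp_apply,
      smul_apply, smul_eq_mul]
    ring
  · have hI : ∀ a : ℕ → ℝ, ∑ t ∈ Finset.Icc 1 P.N, a t = ∑ t ∈ Finset.Icc 1 k, a t + a P.N := by
      intro a
      rw [hk, Finset.sum_Icc_succ_top (by omega)]
    beta_reduce
    rw [hI, cost, mul_add, Finset.mul_sum, Pi.add_apply, Pi.add_apply, ← hk]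
    ring

end Variation

/-! ### Multipliers for the reduced problem -/

/-- The index set of the functions that enter the multiplier rule: `none` stands for the cost,
`some ⟨t, j⟩` for the `j`-th state constraint at time `t`. -/
abbrev MultiplierIndex (P : ControlProblem G nx nu) : Type :=
  Option (Σ t : Finset.Icc 1 P.N, Fin (P.ng t))

/-- The cost and the state constraints as functions of the controls. -/
def reduced (P : ControlProblem G nx nu) (v : ℕ → Eucl nu) : P.MultiplierIndex → ℝ
  | none => P.cost (fun t => (P.flow v t).1) (fun t => (P.flow v t).2) v
  | some p => P.g p.1 (P.flow v p.1).1 (P.flow v p.1).2 p.2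

/-- The covectors `μ^t` that belong to the weights `l`; the sign is that of the maximum
principle. -/
def multiplier (P : ControlProblem G nx nu) (l : P.MultiplierIndex → ℝ) (t : ℕ)
    (j : Fin (P.ng t)) : ℝ :=
  if h : t ∈ Finset.Icc 1 P.N then -l (some ⟨⟨t, h⟩, j⟩) else 0

theorem sum_mul_reduced (l : P.MultiplierIndex → ℝ) (v : ℕ → Eucl nu) :
    ∑ i, l i * P.reduced v i =
      -(-l none * P.cost (fun t => (P.flow v t).1) (fun t => (P.flow v t).2) v +
        ∑ t ∈ Finset.Icc 1 P.N, ∑ j, P.multiplier l t j *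
          P.g t (P.flow v t).1 (P.flow v t).2 j) := by
  rw [Fintype.sum_option, Fintype.sum_sigma, ← Finset.sum_coe_sort (Finset.Icc 1 P.N)]
  have h : ∀ t : Finset.Icc 1 P.N, ∑ j, P.multiplier l t j *
      P.g t (P.flow v t).1 (P.flow v t).2 j =
      -∑ j, l (some ⟨t, j⟩) * P.reduced v (some ⟨t, j⟩) := by
    intro t
    rw [← Finset.sum_neg_distrib]
    refine Finset.sum_congr rfl fun j _ => ?_
    rw [multiplier, dif_pos t.2, reduced]
    ring
  simp only [h, Finset.sum_neg_distrib, reduced]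
  ring

section

variable (hP : P.Standing O) {q : ℕ → G} {x : ℕ → Eucl nx} {u : ℕ → Eucl nu}
include hP

theorem Standing.exists_hasDerivAt_reduced (hF : P.Feasible q x u) (i : P.MultiplierIndex) :
    ∃ φ : (ℕ → Eucl nu) →ₗ[ℝ] ℝ, ∀ δ,
      HasDerivAt (fun ε : ℝ => P.reduced (u + ε • δ) i) (φ δ) 0 := by
  classical
  set l : P.MultiplierIndex → ℝ := Pi.single i 1 with hl
  obtain ⟨ζ, ξ, hadj⟩ := hP.exists_isAdjoint q x u (-l none) (P.multiplier l)
  refine ⟨-∑ t ∈ Finset.range P.N,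
    (P.hamDu O (-l none) t (ζ t) (ξ t) (q t) (x t) (u t)).toLinearMap ∘ₗ LinearMap.proj t,
    fun δ => ?_⟩
  refine ((hP.hasDerivAt_lagrangian hF δ hadj).neg.congr_deriv ?_).congr_of_eventuallyEq
    (Eventually.of_forall fun ε => ?_)
  · simp
  · have h := sum_mul_reduced l (u + ε • δ)
    rw [Pi.neg_apply, ← h, hl]
    simp [Pi.single_apply]

/-- If the cost is decreasing and the active constraints are decreasing to first order in a
feasible direction `δ`, then a small step along `δ` contradicts optimality. -/
theorem Standing.exists_nonneg_direction (hopt : P.IsOptimal q x u)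
    {φ : P.MultiplierIndex → (ℕ → Eucl nu) →ₗ[ℝ] ℝ}
    (hφ : ∀ i δ, HasDerivAt (fun ε : ℝ => P.reduced (u + ε • δ) i) (φ i δ) 0)
    {δ : ℕ → Eucl nu} (hδ : ∀ t < P.N, u t + δ t ∈ P.U t) :
    ∃ i, 0 ≤ i.elim 0 (fun p => P.reduced u (some p)) + φ i δ := by
  by_contra! hneg
  have hflow := hopt.1.flow_eq
  have hcost : P.reduced u none = P.cost q x u := by
    simp only [reduced, cost]
    rw [hflow _ le_rfl]
    congr 1
    refine Finset.sum_congr rfl fun t ht => ?_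
    rw [hflow t (Finset.mem_range.1 ht).le]
  have h1 : ∀ᶠ ε in 𝓝[>] (0 : ℝ), P.reduced (u + ε • δ) none - P.cost q x u < 0 := by
    refine eventually_neg_of_hasDerivAt ((hφ none δ).sub_const _) ?_ ?_
    · simp [hcost]
    · simpa [hcost] using hneg none
  have h2 : ∀ᶠ ε in 𝓝[>] (0 : ℝ), ∀ p, P.reduced (u + ε • δ) (some p) < 0 := by
    refine eventually_all.2 fun p => eventually_neg_of_hasDerivAt (hφ (some p) δ) ?_ ?_
    · have hp := Finset.mem_Icc.1 p.1.2
      simp only [zero_smul, add_zero, reduced]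
      rw [hflow _ hp.2]
      exact hopt.1.state _ hp.1 hp.2 _
    · simpa using hneg (some p)
  have h3 : ∀ᶠ ε in 𝓝[>] (0 : ℝ), ε ∈ Ioo (0 : ℝ) 1 := Ioo_mem_nhdsGT one_pos
  obtain ⟨ε, hε1, hε2, hε3⟩ := (h1.and (h2.and h3)).exists
  have hfeas : P.Feasible (fun t => (P.flow (u + ε • δ) t).1)
      (fun t => (P.flow (u + ε • δ) t).2) (u + ε • δ) :=
    { init_q := rfl
      init_x := rfl
      step_q := fun t _ => rfl
      step_x := fun t _ => rfl
      control := fun t ht => by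
        simpa using (hP.convex_U t ht).add_smul_mem (hopt.1.control t ht) (hδ t ht)
          ⟨hε3.1.le, hε3.2.le⟩
      state := fun t ht1 ht2 j => (hε2 ⟨⟨t, Finset.mem_Icc.2 ⟨ht1, ht2⟩⟩, j⟩).le }
  have := hopt.2 _ _ _ hfeas
  rw [reduced] at hε1
  linarith

/-- The Fritz John multiplier rule for the problem in the controls alone. -/
theorem Standing.exists_multipliers (hopt : P.IsOptimal q x u) :
    ∃ l : P.MultiplierIndex → ℝ, (∀ i, 0 ≤ l i) ∧ l ≠ 0 ∧ (l none = 1 ∨ l none = 0) ∧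
      (∀ p, l (some p) * P.reduced u (some p) = 0) ∧
      ∀ δ : ℕ → Eucl nu, (∀ t < P.N, u t + δ t ∈ P.U t) → ∀ m,
        HasDerivAt (fun ε : ℝ => ∑ i, l i * P.reduced (u + ε • δ) i) m 0 → 0 ≤ m := by
  choose φ hφ using hP.exists_hasDerivAt_reduced hopt.1
  have hle : ∀ p, P.reduced u (some p) ≤ 0 := fun p => by
    have hp := Finset.mem_Icc.1 p.1.2
    rw [reduced, hopt.1.flow_eq _ hp.2]
    exact hopt.1.state _ hp.1 hp.2 _
  have hconv : Convex ℝ {δ : ℕ → Eucl nu | ∀ t < P.N, u t + δ t ∈ P.U t} := by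
    intro δ hδ δ' hδ' a b ha hb hab t ht
    have := hP.convex_U t ht (hδ t ht) (hδ' t ht) ha hb hab
    convert this using 1
    rw [smul_add, smul_add, add_add_add_comm, ← add_smul, hab, one_smul]
    rfl
  have hzero : (0 : ℕ → Eucl nu) ∈ {δ : ℕ → Eucl nu | ∀ t < P.N, u t + δ t ∈ P.U t} :=
    fun t ht => by simpa using hopt.1.control t ht
  obtain ⟨l, hl, hl0, hsep⟩ := exists_nonneg_weights hconv ⟨0, hzero⟩
    (fun i => i.elim 0 (fun p => P.reduced u (some p))) φ
    fun δ hδ => hP.exists_nonneg_direction hopt hφ hδ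
  -- at `δ = 0` a sum of nonpositive terms is nonnegative
  have hslack : ∀ p, l (some p) * P.reduced u (some p) = 0 := by
    have h := hsep 0 hzero
    simp only [map_zero, add_zero, Fintype.sum_option, Option.elim_none, Option.elim_some,
      mul_zero, zero_add] at h
    have hterm : ∀ p ∈ Finset.univ, l (some p) * P.reduced u (some p) ≤ 0 :=
      fun p _ => mul_nonpos_of_nonneg_of_nonpos (hl _) (hle p)
    have hsum := le_antisymm (Finset.sum_nonpos hterm) h
    exact fun p => (Finset.sum_eq_zero_iff_of_nonpos hterm).1 hsum p (Finset.mem_univ p)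
  have hder : ∀ δ : ℕ → Eucl nu, (∀ t < P.N, u t + δ t ∈ P.U t) → 0 ≤ ∑ i, l i * φ i δ := by
    intro δ hδ
    have h := hsep δ hδ
    simp only [mul_add, Finset.sum_add_distrib] at h
    rw [Fintype.sum_option] at h
    simpa [hslack] using h
  have hgen : ∀ c : ℝ, 0 < c → ∀ δ : ℕ → Eucl nu, (∀ t < P.N, u t + δ t ∈ P.U t) → ∀ m,
      HasDerivAt (fun ε : ℝ => ∑ i, (c * l i) * P.reduced (u + ε • δ) i) m 0 → 0 ≤ m := by
    intro c hc δ hδ m hm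
    have h := HasDerivAt.fun_sum (u := Finset.univ) fun i _ => (hφ i δ).const_mul (c * l i)
    rw [hm.unique h]
    simp only [mul_assoc, ← Finset.mul_sum]
    exact mul_nonneg hc.le (hder δ hδ)
  rcases (hl none).eq_or_lt with h0 | h0
  · exact ⟨l, hl, hl0, Or.inr h0.symm, hslack, by simpa using hgen 1 one_pos⟩
  · refine ⟨fun i => (l none)⁻¹ * l i, fun i => mul_nonneg (inv_nonneg.2 h0.le) (hl i),
      fun h => ?_, Or.inl (inv_mul_cancel₀ h0.ne'), fun p => ?_, hgen _ (inv_pos.2 h0)⟩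
    · have := congrFun h none
      simp [h0.ne'] at this
    · rw [mul_assoc, hslack, mul_zero]

end

end ControlProblem
end DiscretePMP

end

open DiscretePMP
theorem theorem1 {n nx nu : ℕ} {𝕜 : Type*} [RCLike 𝕜] (G : MatrixLieGroup n 𝕜)
    (P : ControlProblem G nx nu) (O : Set (lieAlg G)) (hP : P.Standing O)
    (q : ℕ → G) (x : ℕ → Eucl nx) (u : ℕ → Eucl nu) (hopt : P.IsOptimal q x u) :
    ∃ (ζ : ℕ → StrongDual ℝ (lieAlg G)) (ξ : ℕ → StrongDual ℝ (Eucl nx))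
      (μ : (t : ℕ) → Fin (P.ng t) → ℝ) (ν : ℝ),
      (ν = -1 ∨ ν = 0) ∧
      -- state dynamics
      (∀ t < P.N, q (t + 1) = q t * expG (P.hamDζ O ν t (ζ t) (ξ t) (q t) (x t) (u t))) ∧
      (∀ t < P.N, x (t + 1) = P.hamDξ O ν t (ζ t) (ξ t) (q t) (x t) (u t)) ∧
      -- adjoint dynamics
      (∀ t, 1 ≤ t → t < P.N →
        P.rho O ν (t - 1) (ζ (t - 1)) (ξ (t - 1)) (q (t - 1)) (x (t - 1)) (u (t - 1)) =
          AdDual (expG (-P.hamDζ O ν t (ζ t) (ξ t) (q t) (x t) (u t)))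
            (P.rho O ν t (ζ t) (ξ t) (q t) (x t) (u t)) +
          leftTriv (q t) (P.hamDq O ν t (ζ t) (ξ t) (q t) (x t) (u t) +
            P.mulDqg t (μ t) (q t) (x t))) ∧
      (∀ t, 1 ≤ t → t < P.N →
        ξ (t - 1) = P.hamDx O ν t (ζ t) (ξ t) (q t) (x t) (u t) +
          P.mulDxg t (μ t) (q t) (x t)) ∧
      -- transversality conditions
      P.rho O ν (P.N - 1) (ζ (P.N - 1)) (ξ (P.N - 1)) (q (P.N - 1)) (x (P.N - 1))
          (u (P.N - 1)) = leftTriv (q P.N)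
        (ν • groupDeriv (fun q' => P.cN q' (x P.N)) (q P.N) +
          P.mulDqg P.N (μ P.N) (q P.N) (x P.N)) ∧
      ξ (P.N - 1) = ν • fderiv ℝ (fun x' => P.cN (q P.N) x') (x P.N) +
        P.mulDxg P.N (μ P.N) (q P.N) (x P.N) ∧
      -- non-positive gradient condition
      (∀ t < P.N, ∀ w ∈ P.U t,
        P.hamDu O ν t (ζ t) (ξ t) (q t) (x t) (u t) (w - u t) ≤ 0) ∧
      -- complementary slackness
      (∀ t, 1 ≤ t → t ≤ P.N → ∀ j, μ t j * P.g t (q t) (x t) j = 0) ∧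
      -- non-positivity
      (∀ t, 1 ≤ t → t ≤ P.N → ∀ j, μ t j ≤ 0) ∧
      -- non-triviality
      ¬ (ν = 0 ∧ (∀ t < P.N, ζ t = 0 ∧ ξ t = 0) ∧ ∀ t, 1 ≤ t → t ≤ P.N → μ t = 0) := by
  obtain ⟨l, hl, hl0, hnorm, hslack, hder⟩ := hP.exists_multipliers hopt
  obtain ⟨ζ, ξ, hadj⟩ := hP.exists_isAdjoint q x u (-l none) (P.multiplier l)
  have hF := hopt.1
  have hN := hP.N_pos
  refine ⟨ζ, ξ, P.multiplier l, -l none, ?_, ?_, ?_, ?_, ?_, ?_, ?_, ?_, ?_, ?_, ?_⟩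
  · rcases hnorm with h | h <;> simp [h]
  · intro t ht
    rw [hP.expG_hamDζ ht, hF.step_q t ht]
  · intro t ht
    rw [ControlProblem.hamDξ_eq, hF.step_x t ht]
  · intro t h1 ht
    rw [hP.rho_eq (by omega), hP.rho_eq ht, expG_neg, hP.expG_hamDζ ht]
    exact hadj.rho_step t h1 ht
  · exact hadj.xi_step
  · rw [hP.rho_eq (by omega)]
    exact hadj.rho_last
  · exact hadj.xi_last
  · intro t ht w hw
    -- vary the control at time `t` only
    have hδ : ∀ k < P.N, u k + (Pi.single t (w - u t) : ℕ → Eucl nu) k ∈ P.U k := by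
      intro k hk
      by_cases h : k = t
      · subst h; simpa using hw
      · simpa [h] using hF.control k hk
    have hlag := (hP.hasDerivAt_lagrangian hF (Pi.single t (w - u t)) hadj).neg
    have h := hder _ hδ _ (hlag.congr_of_eventuallyEq
      (Eventually.of_forall fun ε => ControlProblem.sum_mul_reduced l _))
    rw [Finset.sum_eq_single_of_mem t (Finset.mem_range.2 ht)
      fun k _ hk => by rw [Pi.single_eq_of_ne hk, map_zero], Pi.single_eq_same] at h
    linarith
  · intro t h1 ht j
    have h := hslack ⟨⟨t, Finset.mem_Icc.2 ⟨h1, ht⟩⟩, j⟩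
    rw [ControlProblem.reduced, hF.flow_eq t ht] at h
    rw [ControlProblem.multiplier, dif_pos (Finset.mem_Icc.2 ⟨h1, ht⟩), neg_mul, h, neg_zero]
  · intro t h1 ht j
    rw [ControlProblem.multiplier, dif_pos (Finset.mem_Icc.2 ⟨h1, ht⟩)]
    exact neg_nonpos.2 (hl _)
  · rintro ⟨hν, -, hμ⟩
    refine hl0 (funext fun i => ?_)
    rcases i with _ | ⟨⟨t, ht⟩, j⟩
    · exact neg_eq_zero.1 hν
    · have h := congrFun (hμ t (Finset.mem_Icc.1 ht).1 (Finset.mem_Icc.1 ht).2) j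
      rw [ControlProblem.multiplier, dif_pos ht] at h
      exact neg_eq_zero.1 h
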